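/- Let $D$ be the open unit disk in $\mathbb{C}$ and let $dA$ be Lebesgue area measure on $D$, normalized so that $A(D)=1$. Write $\|\cdot\|_p$ for the norm of $L^p(D,dA)$ and $\langle f,g\rangle=\int_D f\bar g\,dA$. The Bergman space $L^2_a$ is the Hilbert space of analytic functions on $D$ that belong to $L^2(D,dA)$, and $P$ is the orthogonal projection of $L^2(D,dA)$ onto $L^2_a$. For $u\in L^\infty(D,dA)$ the Toeplitz operator $T_u\colon L^2_a\to L^2_a$ is defined by $T_uf=P(uf)$. For $z\in D$ let $K_z\in L^2_a$ be the reproducing kernel, i.e. $f(z)=\langle f,K_z\rangle$ for all $f\in L^2_a$, and let $k_z=K_z/\|K_z\|_2$. For a bounded operator $S$ on $L^2_a$ its Berezin transform is $\tilde S(z)=\langle Sk_z,k_z\rangle$, $z\in D$. For $z\in D$ let $\varphi_z(w)=\frac{z-w}{1-\bar z w}$, let $U_z\colon L^2_a\to L^2_a$ be the unitary operator $U_zf=(f\circ\varphi_z)\,\varphi_z'$, and let $S_z=U_zSU_z$. By $z\to\partial D$ we mean $|z|\to1$ with $z \in D$. Suppose $S$ is a finite sum of operators of the form $T_{u_1}\cdots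 T_{u_n}$, where each $u_j\in L^\infty(D,dA)$. Then the following are equivalent: (a) $S$ is compact; (b) $\|Sk_z\|_2\to0$ as $z\to\partial D$; (c) $\tilde S(z)\to0$ as $z\to\partial D$; (d) $S_z1\to0$ weakly in $L^2_a$ as $z\to\partial D$; (e) $\|S_z1\|_2\to0$ as $z\to\partial D$; (f) $\|S_z1\|_p\to0$ as $z\to\partial D$ for every $p\in(1,\infty)$. -/

import Mathlib

open MeasureTheory Complex Metric Filter Topology Set
open scoped ENNReal ComplexConjugate Complex.UnitDisc

namespace Bergman

/-- Lebesgue area measure on the open unit disk, normalized to have total mass `1`. -/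
noncomputable def dA : Measure ℂ :=
  (ENNReal.ofReal Real.pi)⁻¹ • volume.restrict (ball (0 : ℂ) 1)

lemma ofReal_pi_ne_zero : ENNReal.ofReal Real.pi ≠ 0 := by simp [Real.pi_pos]

lemma coe_nnreal_pi : (NNReal.pi : ℝ≥0∞) = ENNReal.ofReal Real.pi := by
  rw [ENNReal.ofReal, Real.toNNReal_of_nonneg Real.pi_pos.le]
  rfl

instance : IsProbabilityMeasure dA := by
  constructor
  have h : volume (ball (0 : ℂ) 1) = ENNReal.ofReal Real.pi := by
    rw [Complex.volume_ball, coe_nnreal_pi]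
    simp
  simp only [dA, Measure.smul_apply, Measure.restrict_apply_univ, smul_eq_mul, h]
  exact ENNReal.inv_mul_cancel ofReal_pi_ne_zero ENNReal.ofReal_ne_top

lemma ae_dA : ae dA = ae (volume.restrict (ball (0 : ℂ) 1)) :=
  Measure.ae_ennreal_smul_measure_eq (by simp) _

lemma aestronglyMeasurable_of_diff {g : ℂ → ℂ} (hg : DifferentiableOn ℂ g (ball 0 1)) :
    AEStronglyMeasurable g dA :=
  (hg.continuousOn.aestronglyMeasurable isOpen_ball.measurableSet).smul_measure _

lemma eqOn_of_ae_eq_dA {g h : ℂ → ℂ} (hg : DifferentiableOn ℂ g (ball 0 1))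
    (hh : DifferentiableOn ℂ h (ball 0 1)) (e : g =ᵐ[dA] h) : EqOn g h (ball 0 1) := by
  rw [Filter.EventuallyEq, ae_dA] at e
  exact Measure.eqOn_open_of_ae_eq e isOpen_ball hg.continuousOn hh.continuousOn

lemma circle_mean {f : ℂ → ℂ} (hf : DifferentiableOn ℂ f (ball 0 1)) {z : ℂ} {r : ℝ}
    (hr : 0 < r) (hz : closedBall z r ⊆ ball 0 1) :
    ∫⁻ _ in Ioo (-Real.pi) Real.pi, ‖f z‖ₑ ≤
      ∫⁻ θ in Ioo (-Real.pi) Real.pi, ‖f (z + r * (Real.cos θ + Real.sin θ * I))‖ₑ := by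
  have h1 : Real.circleAverage f z r = f z := by
    apply DiffContOnCl.circleAverage
    rw [abs_of_pos hr]
    apply DifferentiableOn.diffContOnCl
    rw [closure_ball _ hr.ne']
    exact hf.mono hz
  have h2 : (∫ θ in (-Real.pi)..Real.pi, f (circleMap z r θ)) = (2 * Real.pi) • f z := by
    rw [← h1, Real.circleAverage_def, smul_inv_smul₀ (by positivity)]
    have := (periodic_circleMap z r).comp f
    have h3 := this.intervalIntegral_add_eq (-Real.pi) 0
    simp only [Function.comp] at h3
    convert h3 using 2 <;> ring
  have h4 : ∀ θ : ℝ, z + r * (Real.cos θ + Real.sin θ * I) = circleMap z r θ := by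
    intro θ
    simp [circleMap, Complex.exp_mul_I]
  simp only [h4]
  rw [intervalIntegral.integral_of_le (by linarith [Real.pi_pos]),
    integral_Ioc_eq_integral_Ioo] at h2
  calc _ = ‖(2 * Real.pi) • f z‖ₑ := by
        rw [enorm_smul, lintegral_const, Measure.restrict_apply_univ, Real.volume_Ioo, mul_comm]
        congr 1
        rw [Real.enorm_eq_ofReal (by positivity)]
        congr 1; ring
    _ ≤ _ := by rw [← h2]; exact enorm_integral_le_lintegral_enorm _

lemma ball_mean {f : ℂ → ℂ} (hf : DifferentiableOn ℂ f (ball 0 1)) {z : ℂ} {r : ℝ}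
    (hz : ball z r ⊆ ball 0 1) :
    ‖f z‖ₑ * volume (ball (0 : ℂ) r) ≤ ∫⁻ w in ball 0 1, ‖f w‖ₑ := by
  classical
  set G : ℂ → ℝ≥0∞ := (ball (0 : ℂ) r).indicator fun w => ‖f (z + w)‖ₑ with hG
  have hGm : Measurable G := by
    have hc : ContinuousOn (fun w => ‖f (z + w)‖ₑ) (ball (0 : ℂ) r) := by
      apply ContinuousOn.enorm
      apply hf.continuousOn.comp (by fun_prop)
      intro w hw
      apply hz
      simpa using hw
    have := hc.measurable_piecewise (g := 0) continuousOn_const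
      isOpen_ball.measurableSet
    rwa [Set.piecewise_eq_indicator] at this
  have h1 : ∫⁻ w, G w ≤ ∫⁻ w in ball 0 1, ‖f w‖ₑ := by
    rw [← lintegral_sub_right_eq_self G z, ← lintegral_indicator isOpen_ball.measurableSet]
    apply lintegral_mono
    intro w
    by_cases hw : w - z ∈ ball (0 : ℂ) r
    · have : w ∈ ball (0 : ℂ) 1 := hz (by simpa [dist_eq_norm] using hw)
      simp only [hG, indicator_of_mem hw, indicator_of_mem this]
      simp
    · simp only [hG, indicator_of_notMem hw]
      exact zero_le
  refine le_trans ?_ h1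
  rw [← lintegral_indicator_const isOpen_ball.measurableSet,
    ← Complex.lintegral_comp_polarCoord_symm, ← Complex.lintegral_comp_polarCoord_symm,
    polarCoord_target, Measure.volume_eq_prod, ← Measure.prod_restrict]
  have hpm : Measurable fun p : ℝ × ℝ => Complex.polarCoord.symm p := by
    simp only [Complex.polarCoord_symm_apply]; fun_prop
  rw [lintegral_prod, lintegral_prod]
  rotate_left
  · exact (Measurable.smul measurable_fst.ennreal_ofReal (hGm.comp hpm)).aemeasurable
  · exact (Measurable.smul measurable_fst.ennreal_ofReal ((measurable_const.indicator
      isOpen_ball.measurableSet).comp hpm)).aemeasurable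
  refine setLIntegral_mono' measurableSet_Ioi fun ρ hρ => ?_
  have hρ : 0 < ρ := hρ
  have hm : Measurable fun θ : ℝ => G (Complex.polarCoord.symm (ρ, θ)) :=
    hGm.comp (hpm.comp (by fun_prop))
  have hm' : Measurable fun θ : ℝ => (ball (0 : ℂ) r).indicator (fun _ => ‖f z‖ₑ)
      (Complex.polarCoord.symm (ρ, θ)) :=
    (measurable_const.indicator isOpen_ball.measurableSet).comp (hpm.comp (by fun_prop))
  simp only [smul_eq_mul]
  rw [lintegral_const_mul _ hm, lintegral_const_mul _ hm']
  refine mul_le_mul_right ?_ _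
  by_cases hρr : ρ < r
  · have hmem : ∀ θ : ℝ, Complex.polarCoord.symm (ρ, θ) ∈ ball (0 : ℂ) r := by
      intro θ
      rw [mem_ball_zero_iff, Complex.norm_polarCoord_symm, abs_of_pos hρ]
      exact hρr
    simp only [hG, indicator_of_mem (hmem _)]
    simp only [Complex.polarCoord_symm_apply]
    exact circle_mean hf hρ ((closedBall_subset_ball hρr).trans hz)
  · have hmem : ∀ θ : ℝ, Complex.polarCoord.symm (ρ, θ) ∉ ball (0 : ℂ) r := by
      intro θ
      rw [mem_ball_zero_iff, Complex.norm_polarCoord_symm, abs_of_pos hρ]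
      exact hρr
    simp only [hG, indicator_of_notMem (hmem _)]
    exact le_rfl

/-- Point evaluations are bounded in the `L²` norm on holomorphic functions. -/
lemma norm_le_eLpNorm {f : ℂ → ℂ} (hf : DifferentiableOn ℂ f (ball 0 1)) {z : ℂ} {r : ℝ}
    (hr : 0 < r) (hz : ball z r ⊆ ball 0 1) (h2 : MemLp f 2 dA) :
    ‖f z‖ ≤ (r ^ 2)⁻¹ * (eLpNorm f 2 dA).toReal := by
  have h := ball_mean hf hz
  have h1 : eLpNorm f 1 dA ≤ eLpNorm f 2 dA :=
    eLpNorm_le_eLpNorm_of_exponent_le (by norm_num) h2.1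
  rw [eLpNorm_one_eq_lintegral_enorm, dA, lintegral_smul_measure, ← dA] at h1
  rw [Complex.volume_ball] at h
  rw [coe_nnreal_pi] at h
  have h3 : ‖f z‖ₑ * ENNReal.ofReal r ^ 2 ≤ eLpNorm f 2 dA := by
    refine le_trans ?_ h1
    rw [smul_eq_mul, mul_comm _⁻¹, ← div_eq_mul_inv,
      ENNReal.le_div_iff_mul_le (.inl ofReal_pi_ne_zero) (.inl ENNReal.ofReal_ne_top), mul_assoc]
    exact h
  have h4 := ENNReal.toReal_mono h2.2.ne h3
  rw [ENNReal.toReal_mul, ENNReal.toReal_pow, ENNReal.toReal_ofReal hr.le, toReal_enorm] at h4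
  rw [inv_mul_eq_div, le_div_iff₀ (by positivity)]
  exact h4

/-- The Bergman space `L²ₐ`: the (classes of) functions in `L²(D, dA)` that are analytic on `D`. -/
noncomputable def L2a : Submodule ℂ (Lp ℂ 2 dA) where
  carrier := {f | ∃ g : ℂ → ℂ, DifferentiableOn ℂ g (ball 0 1) ∧ f =ᵐ[dA] g}
  add_mem' := by
    rintro a b ⟨g, hg, eg⟩ ⟨h, hh, eh⟩
    exact ⟨g + h, hg.add hh, (Lp.coeFn_add a b).trans (eg.add eh)⟩
  zero_mem' := ⟨0, differentiableOn_const 0, Lp.coeFn_zero ..⟩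
  smul_mem' := by
    rintro c a ⟨g, hg, eg⟩
    exact ⟨c • g, hg.const_smul c, (Lp.coeFn_smul c a).trans (eg.const_smul c)⟩

/-- The analytic function on `D` that represents an element of the Bergman space
(it is unique on `D`; its values off `D` carry no meaning and are never used). -/
noncomputable def toFun (f : L2a) : ℂ → ℂ := Classical.choose f.2

lemma toFun_diff (f : L2a) : DifferentiableOn ℂ (toFun f) (ball 0 1) :=
  (Classical.choose_spec f.2).1

lemma toFun_ae (f : L2a) : (f : Lp ℂ 2 dA) =ᵐ[dA] toFun f := (Classical.choose_spec f.2).2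

lemma toFun_eqOn (f : L2a) {g : ℂ → ℂ} (hg : DifferentiableOn ℂ g (ball 0 1))
    (e : (f : Lp ℂ 2 dA) =ᵐ[dA] g) : EqOn (toFun f) g (ball 0 1) :=
  eqOn_of_ae_eq_dA (toFun_diff f) hg ((toFun_ae f).symm.trans e)

lemma toFun_add (f g : L2a) : EqOn (toFun (f + g)) (toFun f + toFun g) (ball 0 1) :=
  toFun_eqOn _ ((toFun_diff f).add (toFun_diff g))
    ((Lp.coeFn_add (f : Lp ℂ 2 dA) g).trans ((toFun_ae f).add (toFun_ae g)))

lemma toFun_smul (c : ℂ) (f : L2a) : EqOn (toFun (c • f)) (c • toFun f) (ball 0 1) :=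
  toFun_eqOn _ ((toFun_diff f).const_smul c)
    ((Lp.coeFn_smul c (f : Lp ℂ 2 dA)).trans ((toFun_ae f).const_smul c))

lemma memLp_toFun (f : L2a) : MemLp (toFun f) 2 dA := (Lp.memLp _).ae_eq (toFun_ae f)

lemma eLpNorm_toFun (f : L2a) : (eLpNorm (toFun f) 2 dA).toReal = ‖f‖ := by
  rw [← eLpNorm_congr_ae (toFun_ae f), Submodule.coe_norm, Lp.norm_def]

lemma norm_toFun_le (f : L2a) {z : ℂ} {r : ℝ} (hr : 0 < r) (hz : ball z r ⊆ ball 0 1) :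
    ‖toFun f z‖ ≤ (r ^ 2)⁻¹ * ‖f‖ := by
  rw [← eLpNorm_toFun]
  exact norm_le_eLpNorm (toFun_diff f) hr hz (memLp_toFun f)

lemma ball_sub {z : ℂ} : ball z (1 - ‖z‖) ⊆ ball 0 1 :=
  ball_subset_ball' (by simp)

/-- Point evaluation `f ↦ f(z)` at `z ∈ D`, as a bounded linear functional on `L²ₐ`. -/
noncomputable def evalAt (z : 𝔻) : StrongDual ℂ L2a :=
  LinearMap.mkContinuous
    { toFun := fun f => toFun f z
      map_add' := fun f g => toFun_add f g (by simpa using z.norm_lt_one)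
      map_smul' := fun c f => toFun_smul c f (by simpa using z.norm_lt_one) }
    (((1 - ‖(z : ℂ)‖) ^ 2)⁻¹)
    (fun f => norm_toFun_le f (by linarith [z.norm_lt_one]) ball_sub)

lemma sub_toFun (f g : L2a) : EqOn (toFun (f - g)) (toFun f - toFun g) (ball 0 1) :=
  toFun_eqOn _ ((toFun_diff f).sub (toFun_diff g))
    ((Lp.coeFn_sub (f : Lp ℂ 2 dA) g).trans ((toFun_ae f).sub (toFun_ae g)))

lemma isClosed_L2a : IsClosed (L2a : Set (Lp ℂ 2 dA)) := by
  apply IsSeqClosed.isClosed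
  intro x f hx hf
  let y : ℕ → L2a := fun n => ⟨x n, hx n⟩
  have hy : CauchySeq y := by
    have := hf.cauchySeq
    rw [Metric.cauchySeq_iff] at this ⊢
    exact this
  have hloc : ∀ z ∈ ball (0 : ℂ) 1, ∃ t ∈ 𝓝 z, t ⊆ ball 0 1 ∧
      UniformCauchySeqOn (fun n => toFun (y n)) atTop t := by
    intro z hz
    set r := (1 - ‖z‖) / 2 with hr
    have hr0 : 0 < r := by
      rw [mem_ball_zero_iff] at hz; rw [hr]; linarith
    have hb : ∀ w ∈ ball z r, ball w r ⊆ ball 0 1 := by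
      intro w hw
      apply ball_subset_ball'
      rw [mem_ball, dist_eq_norm] at hw
      rw [dist_zero_right]
      have := norm_add_le (w - z) z
      simp only [sub_add_cancel] at this
      linarith
    have ht : ball z r ⊆ ball 0 1 := hb z (mem_ball_self hr0)
    refine ⟨ball z r, ball_mem_nhds z hr0, ht, ?_⟩
    rw [Metric.uniformCauchySeqOn_iff]
    intro ε hε
    obtain ⟨N, hN⟩ := Metric.cauchySeq_iff.1 hy (r ^ 2 * ε) (by positivity)
    refine ⟨N, fun m hm n hn w hw => ?_⟩
    rw [dist_eq_norm]
    have e := sub_toFun (y m) (y n) (ht hw)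
    simp only [Pi.sub_apply] at e
    rw [← e]
    refine (norm_toFun_le _ hr0 (hb w hw)).trans_lt ?_
    rw [inv_mul_lt_iff₀ (by positivity), ← dist_eq_norm]
    exact hN m hm n hn
  have hpt : ∀ z ∈ ball (0 : ℂ) 1, ∃ l, Tendsto (fun n => toFun (y n) z) atTop (𝓝 l) := by
    intro z hz
    obtain ⟨t, ht, -, hu⟩ := hloc z hz
    exact cauchySeq_tendsto_of_complete (hu.cauchySeq (mem_of_mem_nhds ht))
  choose! g hg using hpt
  have hlu : TendstoLocallyUniformlyOn (fun n => toFun (y n)) g atTop (ball 0 1) := by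
    refine tendstoLocallyUniformlyOn_of_forall_exists_nhds fun z hz => ?_
    obtain ⟨t, ht, hts, hu⟩ := hloc z hz
    exact ⟨t, mem_nhdsWithin_of_mem_nhds ht,
      hu.tendstoUniformlyOn_of_tendsto fun w hw => hg w (hts hw)⟩
  refine ⟨g, hlu.differentiableOn (Eventually.of_forall fun n => toFun_diff _) isOpen_ball, ?_⟩
  obtain ⟨ns, hns, hae⟩ := (tendstoInMeasure_of_tendsto_Lp hf).exists_seq_tendsto_ae
  have hall : ∀ᵐ w ∂dA, ∀ n, x n w = toFun (y n) w := ae_all_iff.2 fun n => toFun_ae (y n)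
  have hD : ∀ᵐ w ∂dA, w ∈ ball (0 : ℂ) 1 := by
    rw [ae_dA]; exact ae_restrict_mem isOpen_ball.measurableSet
  filter_upwards [hae, hall, hD] with w h1 h2 h3
  refine tendsto_nhds_unique h1 ?_
  simp only [h2]
  exact (hg w h3).comp hns.tendsto_atTop

instance : CompleteSpace L2a := isClosed_L2a.completeSpace_coe

/-- The Bergman reproducing kernel `K_z`: the element of `L²ₐ` that represents evaluation at `z`
(see `inner_K`). -/
noncomputable def K (z : 𝔻) : L2a := (InnerProductSpace.toDual ℂ L2a).symm (evalAt z)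

lemma inner_K (z : 𝔻) (f : L2a) : inner ℂ (K z) f = toFun f z :=
  InnerProductSpace.toDual_symm_apply

/-- The normalized reproducing kernel `k_z = K_z / ‖K_z‖₂`. -/
noncomputable def k (z : 𝔻) : L2a := (‖K z‖ : ℂ)⁻¹ • K z

/-- The Berezin transform `⟨S k_z, k_z⟩` (Mathlib's inner product is linear in the second slot). -/
noncomputable def berezin (S : L2a →L[ℂ] L2a) (z : 𝔻) : ℂ := inner ℂ (k z) (S (k z))

/-- The Toeplitz operator `T_u f = P(u f)` with symbol `u ∈ L^∞(D, dA)`, where `P` is the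
orthogonal projection of `L²(D, dA)` onto `L²ₐ`. -/
noncomputable def toeplitz (u : Lp ℂ ∞ dA) : L2a →L[ℂ] L2a :=
  L2a.orthogonalProjectionOnto ∘L
    ((ContinuousLinearMap.mul ℂ ℂ).holderL dA ∞ 2 2 u) ∘L L2a.subtypeL

/-- The disk automorphism `φ_z(w) = (z - w) / (1 - z̄ w)`. -/
noncomputable def phi (z : 𝔻) (w : ℂ) : ℂ := (z - w) / (1 - conj (z : ℂ) * w)

lemma den_ne (z : 𝔻) {w : ℂ} (hw : w ∈ ball (0 : ℂ) 1) : 1 - conj (z : ℂ) * w ≠ 0 := by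
  intro h
  have h1 : ‖conj (z : ℂ) * w‖ = 1 := by rw [← sub_eq_zero.1 h]; simp
  rw [norm_mul, RCLike.norm_conj] at h1
  have := z.norm_lt_one
  rw [mem_ball_zero_iff] at hw
  nlinarith [norm_nonneg (z : ℂ), norm_nonneg w]

lemma phi_mem (z : 𝔻) {w : ℂ} (hw : w ∈ ball (0 : ℂ) 1) : phi z w ∈ ball (0 : ℂ) 1 := by
  have hd := den_ne z hw
  rw [mem_ball_zero_iff, phi, norm_div, div_lt_one (norm_pos_iff.2 hd)]
  have hz := z.norm_lt_one
  rw [mem_ball_zero_iff] at hw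
  apply lt_of_pow_lt_pow_left₀ 2 (norm_nonneg _)
  have key : ‖1 - conj (z : ℂ) * w‖ ^ 2 - ‖(z : ℂ) - w‖ ^ 2
      = (1 - ‖(z : ℂ)‖ ^ 2) * (1 - ‖w‖ ^ 2) := by
    simp only [← Complex.normSq_eq_norm_sq, Complex.normSq_apply, Complex.sub_re, Complex.sub_im,
      Complex.mul_re, Complex.mul_im, Complex.conj_re, Complex.conj_im, Complex.one_re,
      Complex.one_im]
    ring
  have : 0 < (1 - ‖(z : ℂ)‖ ^ 2) * (1 - ‖w‖ ^ 2) :=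
    mul_pos (by nlinarith [norm_nonneg (z : ℂ)]) (by nlinarith [norm_nonneg w])
  linarith

lemma phi_phi (z : 𝔻) {w : ℂ} (hw : w ∈ ball (0 : ℂ) 1) : phi z (phi z w) = w := by
  have h1 := den_ne z hw
  have h2 := den_ne z (phi_mem z hw)
  have e : phi z w * (1 - conj (z : ℂ) * w) = z - w := div_mul_cancel₀ _ h1
  rw [phi, div_eq_iff h2]
  linear_combination -e

lemma phi_diff (z : 𝔻) : DifferentiableOn ℂ (phi z) (ball 0 1) := by
  unfold phi
  exact DifferentiableOn.div (by fun_prop) (by fun_prop) fun w hw => den_ne z hw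

lemma phi_injOn (z : 𝔻) : InjOn (phi z) (ball 0 1) := fun a ha b hb h => by
  rw [← phi_phi z ha, h, phi_phi z hb]

lemma phi_image (z : 𝔻) : phi z '' ball 0 1 = ball 0 1 := by
  ext w
  constructor
  · rintro ⟨v, hv, rfl⟩
    exact phi_mem z hv
  · exact fun hw => ⟨phi z w, phi_mem z hw, phi_phi z hw⟩

/-- The function `(f ∘ φ_z) φ_z'`. -/
noncomputable def pullback (z : 𝔻) (f : ℂ → ℂ) (w : ℂ) : ℂ := f (phi z w) * deriv (phi z) w

lemma pullback_diff (z : 𝔻) {f : ℂ → ℂ} (hf : DifferentiableOn ℂ f (ball 0 1)) :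
    DifferentiableOn ℂ (pullback z f) (ball 0 1) :=
  (hf.comp (phi_diff z) fun _ hw => phi_mem z hw).mul ((phi_diff z).deriv isOpen_ball)

lemma eLpNorm_pullback (z : 𝔻) (f : ℂ → ℂ) :
    eLpNorm (pullback z f) 2 dA = eLpNorm f 2 dA := by
  have hd : ∀ w ∈ ball (0 : ℂ) 1, HasFDerivWithinAt (phi z)
      ((ContinuousLinearMap.toSpanSingleton ℂ (deriv (phi z) w)).restrictScalars ℝ)
      (ball 0 1) w := fun w hw =>
    (((phi_diff z).differentiableAt (isOpen_ball.mem_nhds hw)).hasDerivAt.hasFDerivAt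
      |>.restrictScalars ℝ).hasFDerivWithinAt
  have h := lintegral_image_eq_lintegral_abs_det_fderiv_mul volume isOpen_ball.measurableSet hd
    (phi_injOn z) (fun w => ‖f w‖ₑ ^ (2 : ℝ))
  rw [phi_image] at h
  simp only [eLpNorm_eq_lintegral_rpow_enorm_toReal (two_ne_zero) ENNReal.ofNat_ne_top,
    ENNReal.toReal_ofNat]
  rw [dA, lintegral_smul_measure, lintegral_smul_measure, h]
  congr 3
  funext w
  rw [pullback, enorm_mul, ENNReal.mul_rpow_of_nonneg _ _ (by norm_num), mul_comm]
  congr 1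
  have : ((ContinuousLinearMap.toSpanSingleton ℂ (deriv (phi z) w)).restrictScalars ℝ).det
      = ‖deriv (phi z) w‖ ^ 2 := by
    simp [ContinuousLinearMap.det, LinearMap.det_restrictScalars, Algebra.norm_complex_eq,
      Complex.normSq_eq_norm_sq]
  rw [this, abs_of_nonneg (by positivity), ← ofReal_norm,
    ENNReal.ofReal_rpow_of_nonneg (norm_nonneg _) (by norm_num)]
  norm_num

lemma memLp_pullback (z : 𝔻) (f : L2a) : MemLp (pullback z (toFun f)) 2 dA :=
  ⟨aestronglyMeasurable_of_diff (pullback_diff z (toFun_diff f)), by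
    rw [eLpNorm_pullback]; exact (memLp_toFun f).2⟩

lemma pullback_ae {z : 𝔻} {f g : ℂ → ℂ} (h : EqOn f g (ball 0 1)) :
    pullback z f =ᵐ[dA] pullback z g := by
  rw [Filter.EventuallyEq, ae_dA]
  filter_upwards [ae_restrict_mem isOpen_ball.measurableSet] with w hw
  rw [pullback, pullback, h (phi_mem z hw)]

/-- The operator `U_z f = (f ∘ φ_z) φ_z'` on the Bergman space. -/
noncomputable def U (z : 𝔻) : L2a →ₗᵢ[ℂ] L2a where
  toFun f := ⟨(memLp_pullback z f).toLp, pullback z (toFun f), pullback_diff z (toFun_diff f),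
    MemLp.coeFn_toLp _⟩
  map_add' f g := by
    apply Subtype.ext
    refine ((MemLp.toLp_congr (memLp_pullback z (f + g))
      ((memLp_pullback z f).add (memLp_pullback z g)) ?_)).trans
      (MemLp.toLp_add (memLp_pullback z f) (memLp_pullback z g))
    refine (pullback_ae (toFun_add f g)).trans (Eventually.of_forall fun w => ?_)
    simp only [pullback, Pi.add_apply]
    ring
  map_smul' c f := by
    apply Subtype.ext
    refine ((MemLp.toLp_congr (memLp_pullback z (c • f))
      ((memLp_pullback z f).const_smul c) ?_)).trans
      (MemLp.toLp_const_smul c (memLp_pullback z f))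
    refine (pullback_ae (toFun_smul c f)).trans (Eventually.of_forall fun w => ?_)
    simp only [pullback, Pi.smul_apply, smul_eq_mul]
    ring
  norm_map' f := by
    change ‖(memLp_pullback z f).toLp‖ = _
    rw [Lp.norm_toLp, eLpNorm_pullback, eLpNorm_toFun]

/-- The conjugated operator `S_z = U_z S U_z`. -/
noncomputable def conjBy (S : L2a →L[ℂ] L2a) (z : 𝔻) : L2a →L[ℂ] L2a :=
  (U z).toContinuousLinearMap ∘L S ∘L (U z).toContinuousLinearMap

/-- The constant function `1` as an element of the Bergman space. -/
noncomputable def one : L2a :=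
  ⟨(memLp_const (1 : ℂ)).toLp, fun _ => 1, differentiableOn_const 1, MemLp.coeFn_toLp _⟩

/-- The filter `z → ∂D` on the disk: `|z| → 1`. -/
noncomputable def toBoundary : Filter 𝔻 := comap (fun z : 𝔻 => ‖(z : ℂ)‖) (𝓝 1)

end Bergman

open scoped NNReal

/-!
If `S̃` vanishes at `∂D`, every weak operator limit `T` of the conjugates `S_z` as `z → ∂D` has
Berezin transform `0`, since `(S_z)~ = S̃ ∘ φ_z`. As `⟪T K_a, K_b⟫` is holomorphic in `b` and `a̅`,
it is determined by its values on the diagonal, so `T = 0`. Hence `S_z → 0` weakly, in particular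
`S_z 1 → 0` weakly and pointwise; as soon as the `L^r` norms of `S_z 1` are bounded in `z` for some
`r > p`, uniform integrability gives `‖S_z 1‖_p → 0`.

Compactness follows from the Schur test. Write `S = S P`, and cut off the integral
`P f = ∫ f(z) K_z dA(z)` to `|z| ≤ r`: this yields a compact operator `S ∘ truncation r`, and
`S - S ∘ truncation r` has integral kernel `(S K_z)(w)` on `|z| > r`. The identity
`S K_z = (1 - |z|²)⁻¹ ((S_z 1) ∘ φ_z) φ_z'` (up to sign) turns the two Schur integrals against the
weight `(1 - |z|²)^(-2/3)` into `L^q` norms of `S_z 1` and of `S*_z 1` for `q > 3`; the first is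
small near the boundary, the second is bounded.

Finally, Toeplitz operators have these bounds because `T ↦ T_z` preserves products and `(T_u)_z` is
again a Toeplitz operator with symbol of the same norm, and `P` is bounded on each of the growth
spaces `{f : |f| ≤ C (1 - |w|²)^(-ε)}` for `0 < ε < 1`; products of such operators are then bounded
on these spaces as well, uniformly in `z`.
-/

/-! ### Integration -/

section Integration

variable {α β ι E : Type*} [MeasurableSpace α] [MeasurableSpace β] {μ : Measure α}
  {ν : Measure β} [NormedAddCommGroup E]

lemma unifIntegrable_of_eLpNorm_le {f : ι → α → E} {p q C : ℝ≥0∞} (hp : 0 < p) (hpq : p < q)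
    (hC : C ≠ ∞) (hf : ∀ i, AEStronglyMeasurable (f i) μ) (hfC : ∀ i, eLpNorm (f i) q μ ≤ C) :
    UnifIntegrable f p μ := by
  intro ε hε
  set c : ℝ := 1 / p.toReal - 1 / q.toReal
  have hc : 0 < c := by
    rw [sub_pos]
    rcases eq_or_ne q ∞ with rfl | hq
    · simpa using ENNReal.toReal_pos hp.ne' hpq.ne
    · exact one_div_lt_one_div_of_lt (ENNReal.toReal_pos hp.ne' hpq.ne_top)
        (ENNReal.toReal_strict_mono hq hpq)
  have hlim : Tendsto (fun δ : ℝ => C * ENNReal.ofReal δ ^ c) (𝓝[>] 0) (𝓝 0) := by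
    have h := (((ENNReal.tendsto_ofReal (tendsto_id (x := 𝓝 (0 : ℝ)))).ennrpow_const
      c).mono_left nhdsWithin_le_nhds : Tendsto _ (𝓝[>] (0 : ℝ)) _)
    simpa [hc] using ENNReal.Tendsto.const_mul h (.inr hC)
  obtain ⟨δ, hδε, hδ⟩ := ((hlim.eventually_le_const (ENNReal.ofReal_pos.2 hε)).and
    self_mem_nhdsWithin).exists
  refine ⟨δ, hδ, fun i s hs hμs => ?_⟩
  calc eLpNorm (s.indicator (f i)) p μ
      = eLpNorm (f i) p (μ.restrict s) := eLpNorm_indicator_eq_eLpNorm_restrict hs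
    _ ≤ eLpNorm (f i) q (μ.restrict s) * μ.restrict s univ ^ c :=
      eLpNorm_le_eLpNorm_mul_rpow_measure_univ hpq.le (hf i).restrict
    _ ≤ C * ENNReal.ofReal δ ^ c := by
      rw [Measure.restrict_apply_univ]
      gcongr
      exact (eLpNorm_mono_measure _ Measure.restrict_le_self).trans (hfC i)
    _ ≤ ENNReal.ofReal ε := hδε

lemma tendsto_eLpNorm_zero_of_ae_of_eLpNorm_le [IsFiniteMeasure μ] {l : Filter ι}
    [l.IsCountablyGenerated] {f : ι → α → E} {p q C : ℝ≥0∞} (hp : 1 ≤ p) (hpq : p < q)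
    (hC : C ≠ ∞) (hf : ∀ i, AEStronglyMeasurable (f i) μ) (hfC : ∀ i, eLpNorm (f i) q μ ≤ C)
    (hlim : ∀ᵐ x ∂μ, Tendsto (fun i => f i x) l (𝓝 0)) :
    Tendsto (fun i => eLpNorm (f i) p μ) l (𝓝 0) := by
  refine tendsto_of_seq_tendsto fun u hu => ?_
  have h := tendsto_Lp_finite_of_tendsto_ae hp hpq.ne_top (fun n => hf (u n)) MemLp.zero
    (unifIntegrable_of_eLpNorm_le (by positivity) hpq hC (fun n => hf (u n)) fun n => hfC (u n))
    (hlim.mono fun x hx => hx.comp hu)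
  simpa only [sub_zero, Function.comp_def] using h

lemma sq_lintegral_mul_le_mul_lintegral {H g h : α → ℝ≥0∞} (hH : AEMeasurable H μ)
    (hg : AEMeasurable g μ) (hh : AEMeasurable h μ) (h_zero : ∀ᵐ x ∂μ, h x ≠ 0)
    (h_top : ∀ᵐ x ∂μ, h x ≠ ∞) :
    (∫⁻ x, H x * g x ∂μ) ^ 2 ≤
      (∫⁻ x, H x * h x ∂μ) * ∫⁻ x, H x * ((h x)⁻¹ * g x ^ 2) ∂μ := by
  have rpow_half_sq (a : ℝ≥0∞) : (a ^ (1 / 2 : ℝ)) ^ (2 : ℝ) = a := by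
    rw [← ENNReal.rpow_mul]; norm_num
  have hfactor : ∀ᵐ x ∂μ, H x * g x =
      (H x * h x) ^ (1 / 2 : ℝ) * (H x * ((h x)⁻¹ * g x ^ 2)) ^ (1 / 2 : ℝ) := by
    filter_upwards [h_zero, h_top] with x h0 htop
    have hsq : H x * h x * (H x * ((h x)⁻¹ * g x ^ 2)) = (H x * g x) ^ (2 : ℝ) := by
      rw [ENNReal.rpow_two]
      calc H x * h x * (H x * ((h x)⁻¹ * g x ^ 2))
          = h x * (h x)⁻¹ * (H x * g x) ^ 2 := by ring
        _ = (H x * g x) ^ 2 := by rw [ENNReal.mul_inv_cancel h0 htop, one_mul]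
    rw [← ENNReal.mul_rpow_of_nonneg _ _ (by norm_num), hsq, ← ENNReal.rpow_mul]
    norm_num
  have hcs := ENNReal.lintegral_mul_le_Lp_mul_Lq μ Real.HolderConjugate.two_two
    (f := fun x => (H x * h x) ^ (1 / 2 : ℝ))
    (g := fun x => (H x * ((h x)⁻¹ * g x ^ 2)) ^ (1 / 2 : ℝ)) (by fun_prop) (by fun_prop)
  simp only [rpow_half_sq, Pi.mul_apply] at hcs
  rw [lintegral_congr_ae hfactor]
  refine (pow_le_pow_left₀ zero_le hcs 2).trans_eq ?_
  rw [mul_pow, ← ENNReal.rpow_two, ← ENNReal.rpow_two, rpow_half_sq, rpow_half_sq]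

lemma lintegral_sq_lintegral_mul_le_of_schur [SFinite μ] [SFinite ν] {H : α → β → ℝ≥0∞}
    (hH : AEMeasurable (Function.uncurry H) (μ.prod ν)) {h₁ g : α → ℝ≥0∞} {h₂ : β → ℝ≥0∞}
    (hh₁ : AEMeasurable h₁ μ) (hh₂ : AEMeasurable h₂ ν) (h₁_zero : ∀ᵐ x ∂μ, h₁ x ≠ 0)
    (h₁_top : ∀ᵐ x ∂μ, h₁ x ≠ ∞) {A B : ℝ≥0∞}
    (hA : ∀ᵐ x ∂μ, ∫⁻ y, H x y * h₂ y ∂ν ≤ A * h₁ x)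
    (hB : ∀ᵐ y ∂ν, ∫⁻ x, H x y * h₁ x ∂μ ≤ B * h₂ y) (hg : AEMeasurable g μ) :
    ∫⁻ y, (∫⁻ x, H x y * g x ∂μ) ^ 2 ∂ν ≤ A * B * ∫⁻ x, g x ^ 2 ∂μ := by
  have hHx : ∀ᵐ y ∂ν, AEMeasurable (fun x => H x y) μ :=
    hH.prod_swap.aestronglyMeasurable.prodMk_left.mono fun _ h => h.aemeasurable
  have hHy : ∀ᵐ x ∂μ, AEMeasurable (fun y => H x y) ν :=
    hH.aestronglyMeasurable.prodMk_left.mono fun _ h => h.aemeasurable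
  have hprod : AEMeasurable (Function.uncurry fun y x =>
      B * h₂ y * (H x y * ((h₁ x)⁻¹ * g x ^ 2))) (ν.prod μ) := by
    have hfst : AEMeasurable (fun q : β × α => h₂ q.1) (ν.prod μ) := hh₂.comp_fst
    have hsnd : AEMeasurable (fun q : β × α => (h₁ q.2)⁻¹ * g q.2 ^ 2) (ν.prod μ) :=
      (hh₁.inv.mul (hg.pow_const 2)).comp_snd
    exact (hfst.const_mul B).mul (hH.prod_swap.mul hsnd)
  calc ∫⁻ y, (∫⁻ x, H x y * g x ∂μ) ^ 2 ∂ν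
      ≤ ∫⁻ y, B * h₂ y * ∫⁻ x, H x y * ((h₁ x)⁻¹ * g x ^ 2) ∂μ ∂ν := by
        refine lintegral_mono_ae ?_
        filter_upwards [hB, hHx] with y hy hmeas
        grw [sq_lintegral_mul_le_mul_lintegral hmeas hg hh₁ h₁_zero h₁_top, hy]
    _ = ∫⁻ y, ∫⁻ x, B * h₂ y * (H x y * ((h₁ x)⁻¹ * g x ^ 2)) ∂μ ∂ν :=
        lintegral_congr_ae <| hHx.mono fun y hmeas =>
          (lintegral_const_mul'' _ (by fun_prop)).symm
    _ = ∫⁻ x, ∫⁻ y, B * h₂ y * (H x y * ((h₁ x)⁻¹ * g x ^ 2)) ∂ν ∂μ :=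
        lintegral_lintegral_swap hprod
    _ = ∫⁻ x, B * ((h₁ x)⁻¹ * g x ^ 2) * ∫⁻ y, H x y * h₂ y ∂ν ∂μ := by
        refine lintegral_congr_ae (hHy.mono fun x hmeas => ?_)
        simp only
        rw [← lintegral_const_mul'' _ (by fun_prop)]
        exact lintegral_congr fun y => by ring
    _ ≤ ∫⁻ x, A * B * g x ^ 2 ∂μ := by
        refine lintegral_mono_ae ?_
        filter_upwards [hA, h₁_zero, h₁_top] with x hx h0 htop
        calc B * ((h₁ x)⁻¹ * g x ^ 2) * ∫⁻ y, H x y * h₂ y ∂ν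
            ≤ B * ((h₁ x)⁻¹ * g x ^ 2) * (A * h₁ x) := by gcongr
          _ = (h₁ x)⁻¹ * h₁ x * (A * B * g x ^ 2) := by ring
          _ = A * B * g x ^ 2 := by rw [ENNReal.inv_mul_cancel h0 htop, one_mul]
    _ = A * B * ∫⁻ x, g x ^ 2 ∂μ := lintegral_const_mul'' _ (hg.pow_const 2)

end Integration

/-! ### Weak convergence and compact operators -/

section Hilbert

variable {𝕜 E F ι : Type*} [RCLike 𝕜] [NormedAddCommGroup E] [InnerProductSpace 𝕜 E]
  [NormedAddCommGroup F] [InnerProductSpace 𝕜 F] {l : Filter ι} {v : ι → E} {M : ℝ}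

lemma tendsto_inner_zero_of_dense_span (hv : ∀ i, ‖v i‖ ≤ M) {s : Set E}
    (hs : Dense (Submodule.span 𝕜 s : Set E))
    (h : ∀ x ∈ s, Tendsto (fun i => inner 𝕜 x (v i)) l (𝓝 0)) (y : E) :
    Tendsto (fun i => inner 𝕜 y (v i)) l (𝓝 0) := by
  have hlip (i : ι) : LipschitzWith M.toNNReal fun x => inner 𝕜 x (v i) :=
    LipschitzWith.of_dist_le_mul fun x y => by
      rw [dist_eq_norm, dist_eq_norm, ← inner_sub_left, mul_comm]
      exact (norm_inner_le_norm _ _).trans (by grw [hv i, ← Real.le_coe_toNNReal])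
  have hclosed : IsClosed {x | Tendsto (fun i => inner 𝕜 x (v i)) l (𝓝 0)} :=
    (LipschitzWith.uniformEquicontinuous _ _ hlip).equicontinuous.isClosed_setOfPred_tendsto
      continuous_const
  refine hclosed.closure_subset_iff.2 (fun x hx => ?_) (hs y)
  induction hx using Submodule.span_induction with
  | mem x hx => exact h x hx
  | zero => simpa only [mem_ofPred_eq, inner_zero_left] using tendsto_const_nhds
  | add x y _ _ hx hy => simpa [inner_add_left] using hx.add hy
  | smul c x _ hx => simpa [inner_smul_left] using hx.const_mul (starRingEnd 𝕜 c)

lemma tendsto_toWeakSpace_zero_iff [CompleteSpace E] :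
    Tendsto (fun i => toWeakSpace 𝕜 E (v i)) l (𝓝 0) ↔
      ∀ y, Tendsto (fun i => inner 𝕜 y (v i)) l (𝓝 0) := by
  have hinj : Function.Injective (topDualPairing 𝕜 E).flip := fun x y h =>
    ext_inner_left 𝕜 fun z => LinearMap.congr_fun h (innerSL 𝕜 z)
  refine (WeakBilin.tendsto_iff_forall_eval_tendsto _ hinj).trans ?_
  change (∀ φ : E →L[𝕜] 𝕜, Tendsto (fun i => φ (v i)) l (𝓝 (φ 0))) ↔ _
  simp only [map_zero]
  refine ⟨fun h y => h (innerSL 𝕜 y), fun h φ => ?_⟩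
  simpa only [InnerProductSpace.toDual_symm_apply] using h ((InnerProductSpace.toDual 𝕜 E).symm φ)

lemma tendsto_norm_apply_zero_of_isCompactOperator [CompleteSpace E] [CompleteSpace F]
    {T : E →L[𝕜] F} (hT : IsCompactOperator T) (hv : ∀ i, ‖v i‖ ≤ M)
    (h : ∀ x, Tendsto (fun i => inner 𝕜 x (v i)) l (𝓝 0)) :
    Tendsto (fun i => ‖T (v i)‖) l (𝓝 0) := by
  rw [← tendsto_zero_iff_norm_tendsto_zero]
  have hmem (i : ι) : T (v i) ∈ closure (T '' closedBall 0 M) :=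
    subset_closure ⟨v i, by simpa using hv i, rfl⟩
  refine (hT.isCompact_closure_image_closedBall M).tendsto_nhds_of_unique_mapClusterPt
    (Eventually.of_forall hmem) fun y _ hy => ?_
  have hlim : Tendsto (fun i => inner 𝕜 y (T (v i))) l (𝓝 0) := by
    simpa only [ContinuousLinearMap.adjoint_inner_left] using h (ContinuousLinearMap.adjoint T y)
  have hcluster : MapClusterPt (inner 𝕜 y y) l (fun i => inner 𝕜 y (T (v i))) :=
    hy.continuousAt_comp (f := fun x => inner 𝕜 y x) (by fun_prop)
  have : (𝓝 (inner 𝕜 y y) ⊓ 𝓝 0).NeBot := hcluster.neBot.mono (inf_le_inf_left _ hlim)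
  exact inner_self_eq_zero.1 (eq_of_nhds_neBot this)

lemma exists_tendsto_inner_of_ultrafilter [CompleteSpace E] (𝒰 : Ultrafilter ι)
    (hv : ∀ i, ‖v i‖ ≤ M) :
    ∃ y : E, ‖y‖ ≤ M ∧ ∀ x, Tendsto (fun i => inner 𝕜 x (v i)) 𝒰 (𝓝 (inner 𝕜 x y)) := by
  let φ (i : ι) : WeakDual 𝕜 E := StrongDual.toWeakDual (InnerProductSpace.toDual 𝕜 E (v i))
  have hφ : ∀ᶠ i in 𝒰, φ i ∈ WeakDual.toStrongDual ⁻¹' closedBall (0 : StrongDual 𝕜 E) M :=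
    Eventually.of_forall fun i => by
      rw [mem_preimage, mem_closedBall_zero_iff]
      exact ((InnerProductSpace.toDual 𝕜 E).norm_map (v i)).trans_le (hv i)
  obtain ⟨ψ, hψM, hψ⟩ := (WeakDual.isCompact_closedBall (𝕜 := 𝕜) (0 : StrongDual 𝕜 E)
    M).ultrafilter_le_nhds (𝒰.map φ) (le_principal_iff.2 hφ)
  refine ⟨(InnerProductSpace.toDual 𝕜 E).symm (WeakDual.toStrongDual ψ), ?_, fun x => ?_⟩
  · rw [LinearIsometryEquiv.norm_map]
    exact mem_closedBall_zero_iff.1 hψM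
  have hlim : Tendsto (fun i => φ i x) 𝒰 (𝓝 (ψ x)) :=
    ((WeakDual.eval_continuous x).tendsto ψ).comp hψ
  have hconj := (RCLike.continuous_conj.tendsto _).comp hlim
  rw [← inner_conj_symm, InnerProductSpace.toDual_symm_apply]
  exact hconj.congr fun i => inner_conj_symm _ _

lemma exists_tendsto_inner_apply_of_ultrafilter [CompleteSpace F] (𝒰 : Ultrafilter ι)
    {T : ι → E →L[𝕜] F} (hT : ∀ i, ‖T i‖ ≤ M) :
    ∃ T₀ : E →L[𝕜] F, ∀ y x,
      Tendsto (fun i => inner 𝕜 y (T i x)) 𝒰 (𝓝 (inner 𝕜 y (T₀ x))) := by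
  have hTx (x : E) (i : ι) : ‖T i x‖ ≤ M * ‖x‖ := (T i).le_of_opNorm_le (hT i) x
  choose L hLM hL using fun x => exists_tendsto_inner_of_ultrafilter (𝕜 := 𝕜) 𝒰 (hTx x)
  have hadd (x y : E) : L (x + y) = L x + L y :=
    ext_inner_left 𝕜 fun z => tendsto_nhds_unique (hL (x + y) z) <| by
      simpa only [map_add, inner_add_right] using (hL x z).add (hL y z)
  have hsmul (c : 𝕜) (x : E) : L (c • x) = c • L x :=
    ext_inner_left 𝕜 fun z => tendsto_nhds_unique (hL (c • x) z) <| by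
      simpa only [map_smul, inner_smul_right] using (hL x z).const_mul c
  exact ⟨LinearMap.mkContinuous ⟨⟨L, hadd⟩, hsmul⟩ M hLM, fun y x => hL x y⟩

lemma isCompactOperator_rankOne (x : E) (y : F) :
    IsCompactOperator (InnerProductSpace.rankOne 𝕜 x y) :=
  ((isCompactOperator_id (E := 𝕜)).comp_clm (innerSL 𝕜 y)).clm_comp
    (ContinuousLinearMap.toSpanSingleton 𝕜 x)

end Hilbert

lemma enorm_le_rpow_half_of_sq_le {𝕜 E F : Type*} [NontriviallyNormedField 𝕜]
    [SeminormedAddCommGroup E] [NormedSpace 𝕜 E] [SeminormedAddCommGroup F] [NormedSpace 𝕜 F]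
    {T : E →L[𝕜] F} {c : ℝ≥0∞} (h : ∀ x, ‖T x‖ₑ ^ 2 ≤ c * ‖x‖ₑ ^ 2) :
    ‖T‖ₑ ≤ c ^ (1 / 2 : ℝ) := by
  have rpow_half_sq (a : ℝ≥0∞) : (a ^ 2) ^ (1 / 2 : ℝ) = a := by
    rw [← ENNReal.rpow_two, ← ENNReal.rpow_mul]; norm_num
  refine ContinuousLinearMap.opENorm_le_bound _ fun x => ?_
  calc ‖T x‖ₑ = (‖T x‖ₑ ^ 2) ^ (1 / 2 : ℝ) := (rpow_half_sq _).symm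
    _ ≤ (c * ‖x‖ₑ ^ 2) ^ (1 / 2 : ℝ) := by gcongr; exact h x
    _ = c ^ (1 / 2 : ℝ) * ‖x‖ₑ := by
      rw [ENNReal.mul_rpow_of_nonneg _ _ (by norm_num), rpow_half_sq]

section IntegralOfOperators

variable {α X E F : Type*} [MeasurableSpace α] {μ : Measure α}

lemma integral_mem_of_isClosed [NormedAddCommGroup X] [NormedSpace ℝ X] [CompleteSpace X]
    {V : Submodule ℝ X} (hV : IsClosed (V : Set X)) {f : α → X} (hf : ∀ a, f a ∈ V) :
    ∫ a, f a ∂μ ∈ V := by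
  have := hV.completeSpace_coe
  by_cases hf_int : Integrable f μ
  · have hfV : Integrable (fun a => (⟨f a, hf a⟩ : V)) μ :=
      ⟨Topology.IsEmbedding.subtypeVal.aestronglyMeasurable_comp_iff.1 hf_int.1, hf_int.2⟩
    exact V.subtypeL.integral_comp_comm hfV ▸ (∫ a, (⟨f a, hf a⟩ : V) ∂μ).2
  · exact integral_undef hf_int ▸ V.zero_mem

lemma isCompactOperator_integral [NormedAddCommGroup E] [NormedSpace ℂ E]
    [NormedAddCommGroup F] [NormedSpace ℂ F] [CompleteSpace F] {T : α → E →L[ℂ] F}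
    (hT : ∀ a, IsCompactOperator (T a)) : IsCompactOperator (∫ a, T a ∂μ : E →L[ℂ] F) :=
  integral_mem_of_isClosed
    (V := (compactOperator (RingHom.id ℂ) E F).restrictScalars ℝ)
    isClosed_setOfPred_isCompactOperator hT

lemma integrableOn_rankOne [TopologicalSpace α] [OpensMeasurableSpace α] [T2Space α]
    [IsFiniteMeasureOnCompacts μ] [NormedAddCommGroup E] [InnerProductSpace ℂ E]
    [NormedAddCommGroup F] [InnerProductSpace ℂ F] {κ : α → E} {η : α → F} {s : Set α}
    (hs : IsCompact s) (hκ : ContinuousOn κ s) (hη : ContinuousOn η s) :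
    IntegrableOn (fun a => InnerProductSpace.rankOne ℂ (κ a) (η a)) s μ :=
  have hcont : ContinuousOn (fun a => InnerProductSpace.rankOne ℂ (κ a) (η a)) s :=
    ((ContinuousLinearMap.smulRightL ℂ F E).continuous.comp_continuousOn
      ((innerSL ℂ).continuous.comp_continuousOn hη)).clm_apply hκ
  hcont.integrableOn_compact hs

lemma inner_integral_rankOne_apply [NormedAddCommGroup E] [InnerProductSpace ℂ E]
    [CompleteSpace E] [NormedAddCommGroup F] [InnerProductSpace ℂ F] {κ : α → E} {η : α → F}
    (h : Integrable (fun a => InnerProductSpace.rankOne ℂ (κ a) (η a)) μ) (x : E) (y : F) :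
    inner ℂ x ((∫ a, InnerProductSpace.rankOne ℂ (κ a) (η a) ∂μ) y) =
      ∫ a, inner ℂ x (κ a) * inner ℂ (η a) y ∂μ := by
  rw [ContinuousLinearMap.integral_apply h, ← integral_inner (h.apply_continuousLinearMap y)]
  exact integral_congr_ae (Eventually.of_forall fun a => by
    simp [InnerProductSpace.rankOne_apply, inner_smul_right, mul_comm])

end IntegralOfOperators

/-! ### Holomorphic functions of one and two variables -/

section Holomorphic

variable {E : Type*} [NormedAddCommGroup E] [NormedSpace ℂ E] [CompleteSpace E]

lemma differentiableOn_tsum_succ_mul_pow {v : ℕ → E} {M : ℝ} (hv : ∀ n, ‖v n‖ ≤ M) :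
    DifferentiableOn ℂ (fun a : ℂ => ∑' n : ℕ, ((n + 1 : ℂ) * a ^ n) • v n) (ball 0 1) := by
  intro a ha
  obtain ⟨ρ, haρ, hρ⟩ := exists_between (mem_ball_zero_iff.1 ha)
  have hρ0 : 0 ≤ ρ := (norm_nonneg a).trans haρ.le
  have hsum : Summable fun n : ℕ => ((n : ℝ) + 1) * ρ ^ n * M := by
    simpa using (summable_choose_mul_geometric_of_norm_lt_one 1 (r := ρ)
      (by rwa [Real.norm_of_nonneg hρ0])).mul_right M
  have hdiff := differentiableOn_tsum_of_summable_norm hsum (U := ball (0 : ℂ) ρ)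
    (F := fun (n : ℕ) a => ((n + 1 : ℂ) * a ^ n) • v n) (fun n => by fun_prop) isOpen_ball
    (fun n b hb => by
      have hn : ‖(n + 1 : ℂ)‖ = n + 1 := by
        rw [← Nat.cast_succ, Complex.norm_natCast, Nat.cast_succ]
      rw [norm_smul, norm_mul, norm_pow, hn]
      gcongr
      exacts [(mem_ball_zero_iff.1 hb).le, hv n])
  exact (hdiff.differentiableAt
    (isOpen_ball.mem_nhds (by simpa using haρ))).differentiableWithinAt

lemma eqOn_zero_of_real {f : ℂ → E} {r R : ℝ} (hr : 0 < r) (hf : DifferentiableOn ℂ f (ball 0 R))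
    (h0 : ∀ x : ℝ, |x| < r → f x = 0) : EqOn f 0 (ball 0 R) := by
  rcases le_or_gt R 0 with hR | hR
  · simp [ball_eq_empty.2 hR]
  refine (hf.analyticOnNhd isOpen_ball).eqOn_zero_of_preconnected_of_frequently_eq_zero
    (convex_ball (0 : ℂ) R).isPreconnected (mem_ball_self hR) ?_
  have hreal : Tendsto (fun x : ℝ => (x : ℂ)) (𝓝[≠] 0) (𝓝[≠] 0) :=
    Complex.continuous_ofReal.continuousWithinAt.tendsto_nhdsWithin fun x hx => by simpa using hx
  refine hreal.frequently (Eventually.frequently ?_)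
  filter_upwards [nhdsWithin_le_nhds (ball_mem_nhds (0 : ℝ) hr)] with x hx
  exact h0 x (by simpa using hx)

lemma eqOn_zero_of_real_prod {G : ℂ × ℂ → E} {r R : ℝ} (hr : 0 < r)
    (hG : DifferentiableOn ℂ G (ball 0 R))
    (h0 : ∀ x y : ℝ, |x| < r → |y| < r → G (x, y) = 0) : EqOn G 0 (ball 0 R) := by
  have hball {a b : ℂ} : (a, b) ∈ ball (0 : ℂ × ℂ) R ↔ a ∈ ball 0 R ∧ b ∈ ball 0 R := by
    simp [Prod.norm_def]
  rintro ⟨a, b⟩ hab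
  obtain ⟨ha, hb⟩ := hball.1 hab
  have hR : 0 < R := pos_of_mem_ball hb
  refine eqOn_zero_of_real (f := fun b => G (a, b)) (lt_min hr hR)
    (hG.fun_comp (by fun_prop) fun b hb => hball.2 ⟨ha, hb⟩) (fun y hy => ?_) hb
  obtain ⟨hyr, hyR⟩ := lt_min_iff.1 hy
  exact eqOn_zero_of_real (f := fun a => G (a, y)) hr
    (hG.fun_comp (by fun_prop) fun a ha => hball.2 ⟨ha, by simpa using hyR⟩)
    (fun x hx => h0 x y hx hyr) ha

/-- The substitution `(x, y) ↦ (x - iy, x + iy)` carries `ℝ²` onto the antidiagonal. -/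
lemma eqOn_zero_of_antidiagonal {H : ℂ × ℂ → E} (hH : DifferentiableOn ℂ H (ball 0 1))
    (h0 : ∀ b ∈ ball (0 : ℂ) 1, H (conj b, b) = 0) : EqOn H 0 (ball 0 1) := by
  have hlt {x y : ℂ} (hx : ‖x‖ < 1 / 2) (hy : ‖y‖ < 1 / 2) :
      ‖x - I * y‖ < 1 ∧ ‖x + I * y‖ < 1 := by
    constructor
    · refine (norm_sub_le _ _).trans_lt ?_
      rw [norm_mul, norm_I]; linarith
    · refine (norm_add_le _ _).trans_lt ?_
      rw [norm_mul, norm_I]; linarith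
  have hvanish : EqOn (fun p : ℂ × ℂ => H (p.1 - I * p.2, p.1 + I * p.2)) 0 (ball 0 (1 / 2)) := by
    refine eqOn_zero_of_real_prod (r := 1 / 2) (by norm_num)
      (hH.fun_comp (by fun_prop) fun p hp => ?_) fun x y hx hy => ?_
    · rw [mem_ball_zero_iff, Prod.norm_def, max_lt_iff] at hp ⊢
      exact hlt hp.1 hp.2
    · have hb := (hlt (x := x) (y := y) (by simpa using hx) (by simpa using hy)).2
      convert h0 (x + I * y) (by simpa using hb) using 3
      simp [sub_eq_add_neg]
  refine eqOn_zero_of_real_prod (r := 1 / 2) (by norm_num) hH fun s t hs ht => ?_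
  have hmem : ((s + t : ℂ) / 2, I * (s - t) / 2) ∈ ball (0 : ℂ × ℂ) (1 / 2) := by
    have hst : |s + t| < 1 ∧ |s - t| < 1 := by
      constructor <;> rw [abs_lt] at * <;> constructor <;> linarith
    rw [mem_ball_zero_iff, Prod.norm_def, max_lt_iff]
    simp only [norm_div, norm_mul, norm_I, one_mul, ← ofReal_add, ← ofReal_sub, norm_real,
      Real.norm_eq_abs, Complex.norm_ofNat]
    exact ⟨by linarith, by linarith⟩
  have hfst : (s + t : ℂ) / 2 - I * (I * (s - t) / 2) = s := by
    linear_combination (t - s : ℂ) / 2 * I_mul_I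
  have hsnd : (s + t : ℂ) / 2 + I * (I * (s - t) / 2) = t := by
    linear_combination (s - t : ℂ) / 2 * I_mul_I
  simpa only [hfst, hsnd, Pi.zero_apply] using hvanish hmem

end Holomorphic

section CircleAverage

variable {E : Type*} [NormedAddCommGroup E] [NormedSpace ℂ E] [CompleteSpace E]

lemma circleAverage_comp_mul_right_eq {f : ℂ → E} {r : ℝ}
    (hf : DifferentiableOn ℂ f (ball 0 r)) {w : ℂ} (hw : w ∈ ball (0 : ℂ) r) :
    Real.circleAverage (fun ζ => f (ζ * w)) 0 1 = f 0 := by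
  have hmaps : MapsTo (fun ζ => ζ * w) (closedBall (0 : ℂ) 1) (ball 0 r) := fun ζ hζ => by
    rw [mem_closedBall_zero_iff] at hζ
    rw [mem_ball_zero_iff] at hw ⊢
    rw [norm_mul]
    nlinarith [norm_nonneg w, norm_nonneg ζ]
  have hdiff : DifferentiableOn ℂ (fun ζ => f (ζ * w)) (closedBall 0 1) :=
    hf.fun_comp (by fun_prop) hmaps
  rw [DiffContOnCl.circleAverage, zero_mul]
  rw [abs_one]
  apply DifferentiableOn.diffContOnCl
  rwa [closure_ball _ one_ne_zero]

lemma integral_circleAverage_comp_mul_right {μ : Measure ℂ} [SFinite μ]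
    (hμ : ∀ ζ : ℂ, ‖ζ‖ = 1 → MeasurePreserving (ζ * ·) μ μ) {f : ℂ → E} (hf : Integrable f μ) :
    ∫ w, Real.circleAverage (fun ζ => f (ζ * w)) 0 1 ∂μ = ∫ w, f w ∂μ := by
  let ν : Measure ℝ := volume.restrict (Ioc 0 (2 * Real.pi))
  have hν : ν.real univ = 2 * Real.pi := by
    simp [ν, Measure.real, Real.pi_pos.le]
  have hskew : MeasurePreserving (fun p : ℝ × ℂ => (p.1, circleMap 0 1 p.1 * p.2))
      (ν.prod μ) (ν.prod μ) :=
    (MeasurePreserving.id ν).skew_product (g := fun θ w => circleMap 0 1 θ * w)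
      (by unfold Function.uncurry; fun_prop)
      (Eventually.of_forall fun θ => (hμ _ (by simp)).map_eq)
  have hf_int : Integrable (fun p : ℝ × ℂ => f (circleMap 0 1 p.1 * p.2)) (ν.prod μ) :=
    hskew.integrable_comp_of_integrable (hf.comp_snd ν)
  have hrot (θ : ℝ) : ∫ w, f (circleMap 0 1 θ * w) ∂μ = ∫ w, f w ∂μ := by
    have hmp := hμ (circleMap 0 1 θ) (by simp)
    have hmap := integral_map (f := f) hmp.measurable.aemeasurable
      (by rw [hmp.map_eq]; exact hf.1)
    rwa [hmp.map_eq, eq_comm] at hmap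
  simp only [Real.circleAverage_def, intervalIntegral.integral_of_le Real.two_pi_pos.le]
  rw [integral_smul,
    ← integral_integral_swap (f := fun θ w => f (circleMap 0 1 θ * w)) hf_int]
  simp_rw [hrot]
  rw [integral_const, hν]
  exact inv_smul_smul₀ Real.two_pi_pos.ne' _

end CircleAverage

namespace Bergman

/-! ### The disk automorphisms -/

lemma coe_mem_ball (z : 𝔻) : (z : ℂ) ∈ ball (0 : ℂ) 1 := by simpa using z.norm_lt_one

lemma one_sub_norm_sq_pos {w : ℂ} (hw : w ∈ ball (0 : ℂ) 1) : 0 < 1 - ‖w‖ ^ 2 := by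
  rw [mem_ball_zero_iff] at hw
  nlinarith [norm_nonneg w]

lemma ae_mem_ball : ∀ᵐ w ∂dA, w ∈ ball (0 : ℂ) 1 := by
  rw [ae_dA]; exact ae_restrict_mem isOpen_ball.measurableSet

lemma one_sub_norm_le_norm_one_sub_conj_mul (z : 𝔻) (w : ℂ) :
    1 - ‖w‖ ≤ ‖1 - conj (z : ℂ) * w‖ := by
  have h := norm_sub_norm_le (1 : ℂ) (conj (z : ℂ) * w)
  rw [norm_one, norm_mul, RCLike.norm_conj] at h
  nlinarith [norm_nonneg w, z.norm_lt_one]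

lemma hasDerivAt_phi (z : 𝔻) {w : ℂ} (hw : w ∈ ball (0 : ℂ) 1) :
    HasDerivAt (phi z) (-(1 - ‖(z : ℂ)‖ ^ 2 : ℝ) / (1 - conj (z : ℂ) * w) ^ 2) w := by
  have hnum : HasDerivAt (fun w : ℂ => (z : ℂ) - w) (-1) w := by
    simpa using (hasDerivAt_id w).const_sub (z : ℂ)
  have hden : HasDerivAt (fun w : ℂ => 1 - conj (z : ℂ) * w) (-conj (z : ℂ)) w := by
    simpa using ((hasDerivAt_id w).const_mul (conj (z : ℂ))).const_sub 1
  refine (hnum.div hden (den_ne z hw)).congr_deriv ?_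
  push_cast
  rw [← Complex.conj_mul']
  ring

lemma deriv_phi (z : 𝔻) {w : ℂ} (hw : w ∈ ball (0 : ℂ) 1) :
    deriv (phi z) w = -(1 - ‖(z : ℂ)‖ ^ 2 : ℝ) / (1 - conj (z : ℂ) * w) ^ 2 :=
  (hasDerivAt_phi z hw).deriv

lemma norm_deriv_phi (z : 𝔻) {w : ℂ} (hw : w ∈ ball (0 : ℂ) 1) :
    ‖deriv (phi z) w‖ = (1 - ‖(z : ℂ)‖ ^ 2) / ‖1 - conj (z : ℂ) * w‖ ^ 2 := by
  rw [deriv_phi z hw, norm_div, norm_neg, norm_pow, Complex.norm_real, Real.norm_eq_abs,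
    abs_of_pos (one_sub_norm_sq_pos (coe_mem_ball z))]

lemma deriv_phi_mul_deriv_phi (z : 𝔻) {w : ℂ} (hw : w ∈ ball (0 : ℂ) 1) :
    deriv (phi z) (phi z w) * deriv (phi z) w = 1 := by
  have hcomp := (hasDerivAt_phi z (phi_mem z hw)).comp w (hasDerivAt_phi z hw)
  rw [deriv_phi z hw, deriv_phi z (phi_mem z hw)]
  refine hcomp.unique ((hasDerivAt_id w).congr_of_eventuallyEq ?_)
  filter_upwards [isOpen_ball.mem_nhds hw] with v hv using phi_phi z hv

lemma one_sub_norm_phi_sq (z : 𝔻) {w : ℂ} (hw : w ∈ ball (0 : ℂ) 1) :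
    1 - ‖phi z w‖ ^ 2 =
      (1 - ‖(z : ℂ)‖ ^ 2) * (1 - ‖w‖ ^ 2) / ‖1 - conj (z : ℂ) * w‖ ^ 2 := by
  have hden : ‖1 - conj (z : ℂ) * w‖ ^ 2 ≠ 0 := pow_ne_zero 2 (norm_ne_zero_iff.2 (den_ne z hw))
  rw [phi, norm_div, div_pow, eq_div_iff hden, sub_mul, div_mul_cancel₀ _ hden]
  simp only [← Complex.normSq_eq_norm_sq, Complex.normSq_apply, Complex.sub_re, Complex.sub_im,
    Complex.mul_re, Complex.mul_im, Complex.conj_re, Complex.conj_im, Complex.one_re,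
    Complex.one_im]
  ring

lemma lintegral_comp_phi (z : 𝔻) (g : ℂ → ℝ≥0∞) :
    ∫⁻ w, ‖deriv (phi z) w‖ₑ ^ 2 * g (phi z w) ∂dA = ∫⁻ w, g w ∂dA := by
  have hderiv (w : ℂ) (hw : w ∈ ball (0 : ℂ) 1) : HasFDerivWithinAt (phi z)
      ((ContinuousLinearMap.toSpanSingleton ℂ (deriv (phi z) w)).restrictScalars ℝ)
      (ball 0 1) w :=
    (((phi_diff z).differentiableAt (isOpen_ball.mem_nhds hw)).hasDerivAt.hasFDerivAt
      |>.restrictScalars ℝ).hasFDerivWithinAt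
  have hdet (c : ℂ) :
      ((ContinuousLinearMap.toSpanSingleton ℂ c).restrictScalars ℝ).det = ‖c‖ ^ 2 := by
    simp [ContinuousLinearMap.det, LinearMap.det_restrictScalars, Algebra.norm_complex_eq,
      Complex.normSq_eq_norm_sq]
  have hcov := lintegral_image_eq_lintegral_abs_det_fderiv_mul volume isOpen_ball.measurableSet
    hderiv (phi_injOn z) g
  rw [phi_image] at hcov
  rw [dA, lintegral_smul_measure, lintegral_smul_measure, hcov]
  congr 2 with w
  rw [hdet, abs_of_nonneg (by positivity), ENNReal.ofReal_pow (norm_nonneg _), ofReal_norm]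

/-- The automorphism `phi z` as a map of the disk to itself. -/
noncomputable def phiD (z w : 𝔻) : 𝔻 :=
  UnitDisc.mk (phi z w) (mem_ball_zero_iff.1 (phi_mem z (coe_mem_ball w)))

lemma tendsto_one_sub_norm_sq : Tendsto (fun z : 𝔻 => 1 - ‖(z : ℂ)‖ ^ 2) toBoundary (𝓝 0) := by
  have h : Tendsto (fun z : 𝔻 => ‖(z : ℂ)‖) toBoundary (𝓝 1) := tendsto_comap
  simpa using (h.pow 2).const_sub 1

lemma tendsto_phiD_toBoundary (w : 𝔻) : Tendsto (fun z => phiD z w) toBoundary toBoundary := by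
  have hw : 0 < 1 - ‖(w : ℂ)‖ := sub_pos.2 w.norm_lt_one
  have hwsq := one_sub_norm_sq_pos (coe_mem_ball w)
  have hlim : Tendsto (fun z => 1 - ‖(phiD z w : ℂ)‖ ^ 2) toBoundary (𝓝 0) := by
    refine squeeze_zero (g := fun z : 𝔻 =>
      (1 - ‖(z : ℂ)‖ ^ 2) * ((1 - ‖(w : ℂ)‖ ^ 2) / (1 - ‖(w : ℂ)‖) ^ 2))
      (fun z => (one_sub_norm_sq_pos (coe_mem_ball _)).le) (fun z => ?_)
      (by simpa using tendsto_one_sub_norm_sq.mul_const _)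
    have hz := one_sub_norm_sq_pos (coe_mem_ball z)
    rw [phiD, UnitDisc.coe_mk, one_sub_norm_phi_sq z (coe_mem_ball w), mul_div_assoc]
    gcongr
    exact one_sub_norm_le_norm_one_sub_conj_mul z w
  refine tendsto_comap_iff.2 ?_
  simpa [Function.comp_def] using (hlim.const_sub 1).sqrt

/-! ### The Bergman space -/

lemma L2a_ext {f g : L2a} (h : EqOn (toFun f) (toFun g) (ball 0 1)) : f = g := by
  refine Subtype.ext (Lp.ext ((toFun_ae f).trans (EventuallyEq.trans ?_ (toFun_ae g).symm)))
  filter_upwards [ae_mem_ball] with w hw using h hw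

lemma inner_eq_integral (f g : L2a) : inner ℂ f g = ∫ w, conj (toFun f w) * toFun g w ∂dA := by
  rw [Submodule.coe_inner, L2.inner_def]
  refine integral_congr_ae ?_
  filter_upwards [toFun_ae f, toFun_ae g] with w hf hg
  rw [hf, hg, RCLike.inner_apply, mul_comm]

lemma toFun_one : EqOn (toFun one) (fun _ => 1) (ball 0 1) :=
  toFun_eqOn _ (differentiableOn_const 1) (MemLp.coeFn_toLp (memLp_const 1))

lemma measurePreserving_mul {ζ : ℂ} (hζ : ‖ζ‖ = 1) : MeasurePreserving (ζ * ·) dA dA := by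
  have hvol : MeasurePreserving (ζ * ·) (volume : Measure ℂ) volume :=
    (rotation ⟨ζ, by simpa [Submonoid.unitSphere] using hζ⟩).measurePreserving
  have hball : (ζ * ·) ⁻¹' ball (0 : ℂ) 1 = ball 0 1 := by
    ext w; simp [hζ]
  have h := hvol.restrict_preimage (isOpen_ball (x := (0 : ℂ)) (ε := 1)).measurableSet
  rw [hball] at h
  exact h.smul_measure _

lemma integral_toFun (f : L2a) : ∫ w, toFun f w ∂dA = toFun f 0 := by
  have hf : Integrable (toFun f) dA := (memLp_toFun f).integrable one_le_two
  calc ∫ w, toFun f w ∂dA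
      = ∫ w, Real.circleAverage (fun ζ => toFun f (ζ * w)) 0 1 ∂dA :=
        (integral_circleAverage_comp_mul_right (fun _ => measurePreserving_mul) hf).symm
    _ = ∫ _, toFun f 0 ∂dA :=
        integral_congr_ae <|
          ae_mem_ball.mono fun w => circleAverage_comp_mul_right_eq (toFun_diff f)
    _ = toFun f 0 := by simp

lemma inner_one (f : L2a) : inner ℂ one f = toFun f 0 := by
  rw [inner_eq_integral, ← integral_toFun]
  refine integral_congr_ae ?_
  filter_upwards [ae_mem_ball] with w hw
  rw [toFun_one hw, map_one, one_mul]

protected lemma norm_one : ‖one‖ = 1 := by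
  have h : ‖one‖ ^ 2 = 1 := by
    rw [← inner_self_eq_norm_sq (𝕜 := ℂ), inner_one,
      toFun_one (mem_ball_self one_pos), RCLike.one_re]
  exact (pow_eq_one_iff_of_nonneg (norm_nonneg _) two_ne_zero).1 h

/-! ### The unitary operators and the reproducing kernel -/

lemma toFun_U (z : 𝔻) (f : L2a) : EqOn (toFun (U z f)) (pullback z (toFun f)) (ball 0 1) :=
  toFun_eqOn _ (pullback_diff z (toFun_diff f)) (MemLp.coeFn_toLp (memLp_pullback z f))

lemma U_U (z : 𝔻) (f : L2a) : U z (U z f) = f := by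
  refine L2a_ext fun w hw => ?_
  rw [toFun_U z _ hw, pullback, toFun_U z _ (phi_mem z hw), pullback, phi_phi z hw, mul_assoc,
    deriv_phi_mul_deriv_phi z hw, mul_one]

lemma inner_U_left (z : 𝔻) (f g : L2a) : inner ℂ (U z f) g = inner ℂ f (U z g) := by
  rw [← (U z).inner_map_map f, U_U]

lemma U_one (z : 𝔻) : U z one = -((1 - ‖(z : ℂ)‖ ^ 2 : ℝ) : ℂ) • K z := by
  refine ext_inner_right ℂ fun f => ?_
  have hzero : (0 : ℂ) ∈ ball (0 : ℂ) 1 := mem_ball_self one_pos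
  rw [inner_U_left, inner_one, toFun_U z f hzero, pullback, deriv_phi z hzero,
    inner_smul_left (E := L2a), inner_K]
  simp [phi, mul_comm]

lemma K_eq (z : 𝔻) : K z = -((1 - ‖(z : ℂ)‖ ^ 2 : ℝ) : ℂ)⁻¹ • U z one := by
  have h : ((1 - ‖(z : ℂ)‖ ^ 2 : ℝ) : ℂ) ≠ 0 :=
    ofReal_ne_zero.2 (one_sub_norm_sq_pos (coe_mem_ball z)).ne'
  rw [U_one, smul_smul, neg_mul_neg, inv_mul_cancel₀ h, one_smul]

lemma norm_K (z : 𝔻) : ‖K z‖ = (1 - ‖(z : ℂ)‖ ^ 2)⁻¹ := by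
  rw [K_eq, norm_smul, norm_neg, norm_inv, Complex.norm_real, (U z).norm_map, Bergman.norm_one,
    mul_one, Real.norm_eq_abs, abs_of_pos (one_sub_norm_sq_pos (coe_mem_ball z))]

lemma k_eq (z : 𝔻) : k z = -U z one := by
  rw [k, norm_K, U_one, neg_smul, neg_neg, ofReal_inv, inv_inv]

lemma norm_k (z : 𝔻) : ‖k z‖ = 1 := by
  rw [k_eq, norm_neg, (U z).norm_map, Bergman.norm_one]

lemma toFun_K (z : 𝔻) {w : ℂ} (hw : w ∈ ball (0 : ℂ) 1) :
    toFun (K z) w = 1 / (1 - conj (z : ℂ) * w) ^ 2 := by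
  have hz : ((1 - ‖(z : ℂ)‖ ^ 2 : ℝ) : ℂ) ≠ 0 :=
    ofReal_ne_zero.2 (one_sub_norm_sq_pos (coe_mem_ball z)).ne'
  have hden := den_ne z hw
  rw [K_eq, toFun_smul _ _ hw, Pi.smul_apply, toFun_U z _ hw, pullback,
    toFun_one (phi_mem z hw), deriv_phi z hw, one_mul, smul_eq_mul]
  field_simp

lemma U_K (z w : 𝔻) : U z (K w) = conj (deriv (phi z) w) • K (phiD z w) := by
  refine ext_inner_right ℂ fun f => ?_
  rw [inner_U_left, inner_K, inner_smul_left (E := L2a), inner_K, toFun_U z f (coe_mem_ball w),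
    pullback, phiD, UnitDisc.coe_mk, RCLike.conj_conj, mul_comm]

lemma inner_conjBy (S : L2a →L[ℂ] L2a) (z : 𝔻) (f g : L2a) :
    inner ℂ f (conjBy S z g) = inner ℂ (U z f) (S (U z g)) := by
  rw [inner_U_left]; rfl

lemma norm_conjBy_le (S : L2a →L[ℂ] L2a) (z : 𝔻) : ‖conjBy S z‖ ≤ ‖S‖ := by
  refine ContinuousLinearMap.opNorm_le_bound _ (norm_nonneg S) fun f => ?_
  calc ‖conjBy S z f‖ = ‖S (U z f)‖ := (U z).norm_map _
    _ ≤ ‖S‖ * ‖U z f‖ := S.le_opNorm _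
    _ = ‖S‖ * ‖f‖ := by rw [(U z).norm_map]

lemma norm_conjBy_one (S : L2a →L[ℂ] L2a) (z : 𝔻) : ‖conjBy S z one‖ = ‖S (k z)‖ := by
  have h : ‖conjBy S z one‖ = ‖S (U z one)‖ := (U z).norm_map _
  rw [h, k_eq, map_neg, norm_neg]

lemma inner_K_conjBy_K (S : L2a →L[ℂ] L2a) (z w : 𝔻) :
    inner ℂ (K w) (conjBy S z (K w)) = (‖K w‖ ^ 2 : ℝ) * berezin S (phiD z w) := by
  have hK : (‖K (phiD z w)‖ : ℂ) ≠ 0 := by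
    rw [norm_K]
    exact ofReal_ne_zero.2 (inv_pos.2 (one_sub_norm_sq_pos (coe_mem_ball _))).ne'
  have hnorm : ‖K w‖ = ‖deriv (phi z) w‖ * ‖K (phiD z w)‖ := by
    rw [← (U z).norm_map, U_K, norm_smul, RCLike.norm_conj]
  rw [inner_conjBy, U_K, hnorm, berezin, k]
  simp only [map_smul, inner_smul_left (E := L2a), inner_smul_right (E := L2a), RCLike.conj_conj,
    map_inv₀, Complex.conj_ofReal]
  push_cast
  rw [mul_pow, ← Complex.conj_mul' (deriv (phi z) w)]
  field_simp

/-! ### The Berezin transform -/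

lemma ae_norm_pow_le_one (n : ℕ) : ∀ᵐ w : ℂ ∂dA, ‖w ^ n‖ ≤ 1 := by
  filter_upwards [ae_mem_ball] with w hw
  rw [norm_pow]
  exact pow_le_one₀ (norm_nonneg w) (mem_ball_zero_iff.1 hw).le

lemma memLp_pow (n : ℕ) : MemLp (fun w : ℂ => w ^ n) 2 dA :=
  MemLp.of_bound (by fun_prop) 1 (ae_norm_pow_le_one n)

/-- The monomial `w ^ n` as an element of the Bergman space. -/
noncomputable def monomial (n : ℕ) : L2a :=
  ⟨(memLp_pow n).toLp, fun w => w ^ n, by fun_prop, MemLp.coeFn_toLp _⟩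

lemma toFun_monomial (n : ℕ) : EqOn (toFun (monomial n)) (fun w => w ^ n) (ball 0 1) :=
  toFun_eqOn _ (by fun_prop) (MemLp.coeFn_toLp (memLp_pow n))

lemma norm_monomial_le (n : ℕ) : ‖monomial n‖ ≤ 1 := by
  change ‖(memLp_pow n).toLp‖ ≤ 1
  rw [Lp.norm_toLp]
  exact ENNReal.toReal_le_of_le_ofReal zero_le_one <| by
    simpa using eLpNorm_le_of_ae_bound (p := 2) (ae_norm_pow_le_one n)

/-- The kernel `K` reparametrized by the conjugate of the point, `conjKernel a = K (conj a)`, so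
that it depends holomorphically on `a`. -/
noncomputable def conjKernel (a : ℂ) : L2a := ∑' n : ℕ, ((n + 1 : ℂ) * a ^ n) • monomial n

lemma differentiableOn_conjKernel : DifferentiableOn ℂ conjKernel (ball 0 1) :=
  differentiableOn_tsum_succ_mul_pow norm_monomial_le

lemma hasSum_conjKernel {a : ℂ} (ha : a ∈ ball (0 : ℂ) 1) :
    HasSum (fun n : ℕ => ((n + 1 : ℂ) * a ^ n) • monomial n) (conjKernel a) := by
  have hgeom : Summable fun n : ℕ => ((n : ℝ) + 1) * ‖a‖ ^ n := by
    simpa using summable_choose_mul_geometric_of_norm_lt_one 1 (r := ‖a‖) (by simpa using ha)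
  refine (Summable.of_norm_bounded hgeom fun n => ?_).hasSum
  have hn : ‖(n + 1 : ℂ)‖ = n + 1 := by
    rw [← Nat.cast_succ, Complex.norm_natCast, Nat.cast_succ]
  rw [norm_smul, norm_mul, norm_pow, hn]
  exact mul_le_of_le_one_right (by positivity) (norm_monomial_le n)

lemma conj_mem_ball {b : ℂ} (hb : b ∈ ball (0 : ℂ) 1) : conj b ∈ ball (0 : ℂ) 1 := by
  simpa using hb

lemma conjKernel_conj (z : 𝔻) : conjKernel (conj (z : ℂ)) = K z := by
  refine L2a_ext fun w hw => ?_
  lift w to 𝔻 using mem_ball_zero_iff.1 hw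
  have hsum := (hasSum_conjKernel (conj_mem_ball (coe_mem_ball z))).mapL (evalAt w)
  have hlt : ‖conj (z : ℂ) * w‖ < 1 := by
    rw [norm_mul, RCLike.norm_conj]
    exact mul_lt_one_of_nonneg_of_lt_one_left (norm_nonneg _) z.norm_lt_one w.norm_lt_one.le
  have hterm (n : ℕ) : evalAt w (((n + 1 : ℂ) * conj (z : ℂ) ^ n) • monomial n) =
      ((n + 1).choose 1 : ℕ) * (conj (z : ℂ) * w) ^ n := by
    rw [map_smul, show evalAt w (monomial n) = toFun (monomial n) w from rfl,
      toFun_monomial n hw, smul_eq_mul, Nat.choose_one_right, mul_pow]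
    push_cast
    ring
  simp only [hterm] at hsum
  rw [toFun_K z hw]
  exact hsum.unique (hasSum_choose_mul_geometric_of_norm_lt_one 1 hlt)

lemma differentiableOn_innerSL_conjKernel_conj :
    DifferentiableOn ℂ (fun b => innerSL ℂ (conjKernel (conj b))) (ball 0 1) := by
  refine (differentiableOn_tsum_succ_mul_pow (v := fun n => innerSL ℂ (monomial n)) (M := 1)
    fun n => ?_).congr fun b hb => ?_
  · rw [innerSL_apply_norm]
    exact norm_monomial_le n
  · have hsum := (hasSum_conjKernel (conj_mem_ball hb)).mapL (innerSL ℂ (E := L2a))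
    rw [← hsum.tsum_eq]
    refine tsum_congr fun n => ?_
    simp

lemma dense_span_K : Dense (Submodule.span ℂ (range K) : Set L2a) := by
  rw [Submodule.dense_iff_topologicalClosure_eq_top, Submodule.topologicalClosure_eq_top_iff,
    Submodule.eq_bot_iff]
  intro f hf
  refine L2a_ext fun w hw => ?_
  lift w to 𝔻 using mem_ball_zero_iff.1 hw
  rw [← inner_K w f, ← inner_K w 0,
    (Submodule.mem_orthogonal _ _).1 hf _ (Submodule.subset_span ⟨w, rfl⟩)]
  exact (inner_zero_right _).symm

lemma eq_zero_of_inner_K_eq_zero {T : L2a →L[ℂ] L2a}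
    (hT : ∀ w : 𝔻, inner ℂ (K w) (T (K w)) = 0) : T = 0 := by
  have hfst : MapsTo Prod.fst (ball (0 : ℂ × ℂ) 1) (ball 0 1) := fun p hp => by
    rw [mem_ball_zero_iff] at hp ⊢; exact (norm_fst_le p).trans_lt hp
  have hsnd : MapsTo Prod.snd (ball (0 : ℂ × ℂ) 1) (ball 0 1) := fun p hp => by
    rw [mem_ball_zero_iff] at hp ⊢; exact (norm_snd_le p).trans_lt hp
  have hleft : DifferentiableOn ℂ (fun p : ℂ × ℂ => innerSL ℂ (conjKernel (conj p.2)))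
      (ball 0 1) :=
    DifferentiableOn.comp (𝕜 := ℂ) (E := ℂ × ℂ) (F := ℂ) (G := L2a →L[ℂ] ℂ)
      differentiableOn_innerSL_conjKernel_conj differentiableOn_snd hsnd
  have hright : DifferentiableOn ℂ (fun p : ℂ × ℂ => T (conjKernel p.1)) (ball 0 1) :=
    T.differentiable.comp_differentiableOn
      (differentiableOn_conjKernel.comp differentiableOn_fst hfst)
  have hH : DifferentiableOn ℂ
      (fun p : ℂ × ℂ => innerSL ℂ (conjKernel (conj p.2)) (T (conjKernel p.1))) (ball 0 1) :=
    hleft.clm_apply hright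
  have hzero := eqOn_zero_of_antidiagonal hH fun b hb => by
    lift b to 𝔻 using mem_ball_zero_iff.1 hb
    simpa [conjKernel_conj] using hT b
  refine ContinuousLinearMap.ext_on dense_span_K ?_
  rintro _ ⟨z, rfl⟩
  refine L2a_ext fun w hw => ?_
  lift w to 𝔻 using mem_ball_zero_iff.1 hw
  rw [← inner_K, ← inner_K, zero_apply, inner_zero_right (E := L2a)]
  have hmem : (conj (z : ℂ), (w : ℂ)) ∈ ball (0 : ℂ × ℂ) 1 := by
    simp [Prod.norm_def, z.norm_lt_one, w.norm_lt_one]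
  simpa [conjKernel_conj] using hzero hmem

lemma tendsto_inner_conjBy_of_tendsto_berezin {S : L2a →L[ℂ] L2a}
    (hS : Tendsto (berezin S) toBoundary (𝓝 0)) (f g : L2a) :
    Tendsto (fun z => inner ℂ g (conjBy S z f)) toBoundary (𝓝 0) := by
  refine (tendsto_iff_ultrafilter _ _ _).2 fun 𝒰 h𝒰 => ?_
  obtain ⟨T, hT⟩ := exists_tendsto_inner_apply_of_ultrafilter 𝒰 (norm_conjBy_le S)
  have hT0 : T = 0 := by
    refine eq_zero_of_inner_K_eq_zero fun w => tendsto_nhds_unique (hT (K w) (K w)) ?_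
    have h := (hS.comp (tendsto_phiD_toBoundary w)).const_mul ((‖K w‖ ^ 2 : ℝ) : ℂ)
    rw [mul_zero] at h
    simpa only [inner_K_conjBy_K, Function.comp_def] using h.mono_left h𝒰
  simpa only [hT0, zero_apply, inner_zero_right (E := L2a)] using hT g f

lemma tendsto_inner_k (g : L2a) : Tendsto (fun z => inner ℂ g (k z)) toBoundary (𝓝 0) := by
  refine tendsto_inner_zero_of_dense_span (fun z => (norm_k z).le) dense_span_K ?_ g
  rintro _ ⟨w, rfl⟩
  have hbound (z : 𝔻) :
      ‖inner ℂ (K w) (k z)‖ ≤ (1 - ‖(z : ℂ)‖ ^ 2) * ((1 - ‖(w : ℂ)‖) ^ 2)⁻¹ := by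
    have hz := one_sub_norm_sq_pos (coe_mem_ball z)
    have hw : 0 < 1 - ‖(w : ℂ)‖ := sub_pos.2 w.norm_lt_one
    rw [k, inner_smul_right (E := L2a), inner_K, toFun_K z (coe_mem_ball w), norm_K, norm_mul,
      ofReal_inv, inv_inv, Complex.norm_real, Real.norm_eq_abs, abs_of_pos hz, one_div, norm_inv,
      norm_pow]
    gcongr
    exact one_sub_norm_le_norm_one_sub_conj_mul z w
  exact squeeze_zero_norm hbound (by simpa using tendsto_one_sub_norm_sq.mul_const _)

end Bergman

/-! ### Power weights -/

lemma ennreal_rpow_neg_le_rpow_neg {a b : ℝ≥0∞} (h : a ≤ b) {s : ℝ} (hs : 0 ≤ s) :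
    b ^ (-s) ≤ a ^ (-s) := by
  rw [ENNReal.rpow_neg, ENNReal.rpow_neg]
  gcongr

lemma setLIntegral_Ioo_rpow_neg_lt_top {κ b : ℝ} (hb : 0 < b) (hκ : κ < 1) :
    ∫⁻ x in Ioo 0 b, ENNReal.ofReal x ^ (-κ) < ∞ := by
  have hf_int : IntegrableOn (fun x : ℝ => x ^ (-κ)) (Ioo 0 b) :=
    (intervalIntegral.integrableOn_Ioo_rpow_iff hb).2 (by linarith)
  refine hf_int.setLIntegral_lt_top.trans_eq' ?_
  exact setLIntegral_congr_fun measurableSet_Ioo fun x hx => (ENNReal.ofReal_rpow_of_pos hx.1).symm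

lemma setLIntegral_Ioo_comp_sub_left (f : ℝ → ℝ≥0∞) (a : ℝ) :
    ∫⁻ x in Ioo 0 a, f (a - x) = ∫⁻ x in Ioo 0 a, f x := by
  have h := (Measure.measurePreserving_sub_left volume a).setLIntegral_comp_preimage_emb
    (MeasurableEquiv.subLeft a).measurableEmbedding f (Ioo 0 a)
  simpa using h

lemma setLIntegral_Ioo_comp_abs_le (f : ℝ → ℝ≥0∞) (a : ℝ) :
    ∫⁻ x in Ioo (-a) a, f |x| ≤ 2 * ∫⁻ x in Ioo 0 a, f x := by
  have hneg : ∫⁻ x in Ioo (-a) 0, f |x| = ∫⁻ x in Ioo 0 a, f |x| := by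
    have h := (Measure.measurePreserving_neg (volume : Measure ℝ)).setLIntegral_comp_preimage_emb
      (MeasurableEquiv.neg ℝ).measurableEmbedding (fun x => f |x|) (Ioo 0 a)
    simpa using h
  have hpos : ∫⁻ x in Ioo 0 a, f |x| = ∫⁻ x in Ioo 0 a, f x :=
    setLIntegral_congr_fun measurableSet_Ioo fun x hx => by simp only [abs_of_pos hx.1]
  calc ∫⁻ x in Ioo (-a) a, f |x|
      ≤ ∫⁻ x in Ioo (-a) 0 ∪ Ico 0 a, f |x| := lintegral_mono_set Ioo_subset_Ioo_union_Ico
    _ ≤ (∫⁻ x in Ioo (-a) 0, f |x|) + ∫⁻ x in Ico 0 a, f |x| := lintegral_union_le _ _ _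
    _ = 2 * ∫⁻ x in Ioo 0 a, f x := by
      rw [hneg, setLIntegral_congr Ioo_ae_eq_Ico.symm, hpos, two_mul]

lemma abs_div_pi_le_norm_one_sub {ρ θ : ℝ} (hρ : ρ ∈ Icc (0 : ℝ) 1) (hθ : |θ| ≤ Real.pi) :
    |θ| / Real.pi ≤ ‖1 - (ρ : ℂ) * exp (I * θ)‖ := by
  have hnorm : ‖exp (I * θ)‖ = 1 := Complex.norm_exp_I_mul_ofReal θ
  have hsin : 2 / Real.pi * |θ| ≤ ‖exp (I * θ) - 1‖ := by
    rw [Complex.norm_exp_I_mul_ofReal_sub_one, norm_mul, Real.norm_ofNat, Real.norm_eq_abs]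
    have h := Real.mul_abs_le_abs_sin (x := θ / 2) (by rw [abs_div, abs_two]; linarith)
    rw [abs_div, abs_two] at h
    linarith
  have hradial : 1 - ρ ≤ ‖1 - (ρ : ℂ) * exp (I * θ)‖ := by
    have h := norm_sub_norm_le 1 ((ρ : ℂ) * exp (I * θ))
    rwa [norm_one, norm_mul, hnorm, mul_one, Complex.norm_of_nonneg hρ.1] at h
  have hsplit : exp (I * θ) - 1 = (1 - ρ : ℝ) * exp (I * θ) - (1 - (ρ : ℂ) * exp (I * θ)) := by
    push_cast; ring
  have htri : ‖exp (I * θ) - 1‖ ≤ (1 - ρ) + ‖1 - (ρ : ℂ) * exp (I * θ)‖ := by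
    rw [hsplit]
    refine (norm_sub_le _ _).trans_eq ?_
    rw [norm_mul, hnorm, mul_one, Complex.norm_of_nonneg (by linarith [hρ.2])]
  have : |θ| / Real.pi * 2 = 2 / Real.pi * |θ| := by ring
  linarith

namespace Bergman

lemma lintegral_dA_le_of_le_polar {F : ℂ → ℝ≥0∞} {A B : ℝ → ℝ≥0∞} (hA : Measurable A)
    (hB : Measurable B)
    (h : ∀ ρ ∈ Ioo (0 : ℝ) 1, ∀ θ ∈ Ioo (-Real.pi) Real.pi,
      F (ρ * exp (I * θ)) ≤ A ρ * B θ) :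
    ∫⁻ w, F w ∂dA ≤ (ENNReal.ofReal Real.pi)⁻¹ *
      ((∫⁻ ρ in Ioo 0 1, A ρ) * ∫⁻ θ in Ioo (-Real.pi) Real.pi, B θ) := by
  have hsymm (p : ℝ × ℝ) : Complex.polarCoord.symm p = p.1 * exp (I * p.2) := by
    rw [Complex.polarCoord_symm_apply, mul_comm I, Complex.exp_mul_I, ofReal_cos, ofReal_sin]
  have hle (p : ℝ × ℝ) (hp : p ∈ Ioi (0 : ℝ) ×ˢ Ioo (-Real.pi) Real.pi) :
      ENNReal.ofReal p.1 • (ball 0 1).indicator F (Complex.polarCoord.symm p) ≤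
        (Ioo 0 1).indicator A p.1 * B p.2 := by
    by_cases hp1 : p.1 < 1
    · have hmem : Complex.polarCoord.symm p ∈ ball (0 : ℂ) 1 := by
        rwa [mem_ball_zero_iff, Complex.norm_polarCoord_symm, abs_of_pos hp.1]
      rw [indicator_of_mem hmem, indicator_of_mem (show p.1 ∈ Ioo 0 1 from ⟨hp.1, hp1⟩), hsymm]
      exact (mul_le_of_le_one_left zero_le (ENNReal.ofReal_le_one.2 hp1.le)).trans
        (h _ ⟨hp.1, hp1⟩ _ hp.2)
    · have hmem : Complex.polarCoord.symm p ∉ ball (0 : ℂ) 1 := by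
        rwa [mem_ball_zero_iff, Complex.norm_polarCoord_symm, abs_of_pos hp.1]
      rw [indicator_of_notMem hmem, smul_zero]
      exact zero_le
  rw [dA, lintegral_smul_measure, smul_eq_mul, ← lintegral_indicator isOpen_ball.measurableSet,
    ← Complex.lintegral_comp_polarCoord_symm, polarCoord_target]
  gcongr
  calc _ ≤ ∫⁻ p in Ioi (0 : ℝ) ×ˢ Ioo (-Real.pi) Real.pi, (Ioo 0 1).indicator A p.1 * B p.2 :=
        setLIntegral_mono' (measurableSet_Ioi.prod measurableSet_Ioo) hle
    _ = (∫⁻ ρ in Ioi 0, (Ioo 0 1).indicator A ρ) * ∫⁻ θ in Ioo (-Real.pi) Real.pi, B θ := by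
        rw [Measure.volume_eq_prod, ← Measure.prod_restrict, lintegral_prod_mul
          (hA.indicator measurableSet_Ioo).aemeasurable hB.aemeasurable]
    _ ≤ _ := by
        grw [setLIntegral_le_lintegral, lintegral_indicator measurableSet_Ioo]

/-- The weight `(1 - ‖w‖ ^ 2) ^ (-t)` on the disk, with values in `ℝ≥0∞`. -/
noncomputable def wt (t : ℝ) (w : ℂ) : ℝ≥0∞ := ENNReal.ofReal (1 - ‖w‖ ^ 2) ^ (-t)

lemma measurable_wt (t : ℝ) : Measurable (wt t) := by
  unfold wt; fun_prop

lemma ofReal_one_sub_norm_sq_ne_zero {w : ℂ} (hw : w ∈ ball (0 : ℂ) 1) :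
    ENNReal.ofReal (1 - ‖w‖ ^ 2) ≠ 0 := by
  simpa using one_sub_norm_sq_pos hw

lemma wt_ne_zero (t : ℝ) {w : ℂ} (hw : w ∈ ball (0 : ℂ) 1) : wt t w ≠ 0 :=
  (ENNReal.rpow_pos (pos_iff_ne_zero.2 (ofReal_one_sub_norm_sq_ne_zero hw))
    ENNReal.ofReal_ne_top).ne'

lemma wt_ne_top (t : ℝ) {w : ℂ} (hw : w ∈ ball (0 : ℂ) 1) : wt t w ≠ ∞ :=
  ENNReal.rpow_ne_top_of_ne_zero (ofReal_one_sub_norm_sq_ne_zero hw) ENNReal.ofReal_ne_top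

lemma one_le_wt {t : ℝ} (ht : 0 ≤ t) (w : ℂ) : 1 ≤ wt t w := by
  rw [wt, ENNReal.rpow_neg, ENNReal.one_le_inv]
  exact ENNReal.rpow_le_one (ENNReal.ofReal_le_one.2 (sub_le_self 1 (sq_nonneg _))) ht

lemma wt_rpow (t r : ℝ) (w : ℂ) : wt t w ^ r = wt (t * r) w := by
  rw [wt, wt, ← ENNReal.rpow_mul, neg_mul]

lemma wt_mul_left {ζ : ℂ} (hζ : ‖ζ‖ = 1) (t : ℝ) (w : ℂ) : wt t (ζ * w) = wt t w := by
  rw [wt, wt, norm_mul, hζ, one_mul]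

lemma enorm_one_sub_rpow_mul_wt_le {s t κ ρ θ : ℝ} (ht : 0 ≤ t) (hκ : 0 ≤ κ) (hκs : κ ≤ s)
    (hρ : ρ ∈ Ioo (0 : ℝ) 1) (hθ : |θ| ≤ Real.pi) :
    ‖1 - (ρ : ℂ) * exp (I * θ)‖ₑ ^ (-s) * wt t (ρ * exp (I * θ)) ≤
      ENNReal.ofReal (1 - ρ) ^ (-(s + t - κ)) * ENNReal.ofReal (|θ| / Real.pi) ^ (-κ) := by
  set w : ℂ := ρ * exp (I * θ) with hw
  have hnorm : ‖w‖ = ρ := by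
    rw [hw, norm_mul, Complex.norm_exp_I_mul_ofReal, mul_one, Complex.norm_of_nonneg hρ.1.le]
  have hpos : ENNReal.ofReal (1 - ρ) ≠ 0 := by simpa using hρ.2
  have hradial : ENNReal.ofReal (1 - ρ) ≤ ‖1 - w‖ₑ := by
    rw [← ofReal_norm]
    refine ENNReal.ofReal_le_ofReal ?_
    simpa [hnorm] using norm_sub_norm_le 1 w
  have hangular : ENNReal.ofReal (|θ| / Real.pi) ≤ ‖1 - w‖ₑ := by
    rw [← ofReal_norm]
    exact ENNReal.ofReal_le_ofReal (abs_div_pi_le_norm_one_sub (Ioo_subset_Icc_self hρ) hθ)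
  have hwt : wt t w ≤ ENNReal.ofReal (1 - ρ) ^ (-t) := by
    rw [wt, hnorm]
    exact ennreal_rpow_neg_le_rpow_neg (ENNReal.ofReal_le_ofReal (by nlinarith [hρ.1, hρ.2])) ht
  have hne : ‖1 - w‖ₑ ≠ 0 := fun h => hpos (le_antisymm (h ▸ hradial) zero_le)
  calc ‖1 - w‖ₑ ^ (-s) * wt t w
      = ‖1 - w‖ₑ ^ (-(s - κ)) * ‖1 - w‖ₑ ^ (-κ) * wt t w := by
        rw [← ENNReal.rpow_add _ _ hne enorm_ne_top]
        ring_nf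
    _ ≤ ENNReal.ofReal (1 - ρ) ^ (-(s - κ)) * ENNReal.ofReal (|θ| / Real.pi) ^ (-κ) *
          ENNReal.ofReal (1 - ρ) ^ (-t) := by
        have hradial' := ennreal_rpow_neg_le_rpow_neg hradial (sub_nonneg.2 hκs)
        have hangular' := ennreal_rpow_neg_le_rpow_neg hangular hκ
        exact mul_le_mul' (mul_le_mul' hradial' hangular') hwt
    _ = _ := by
        rw [mul_right_comm, ← ENNReal.rpow_add _ _ hpos ENNReal.ofReal_ne_top]
        ring_nf

lemma lintegral_enorm_one_sub_rpow_mul_wt_lt_top {s t : ℝ} (hs : 0 ≤ s) (ht : 0 ≤ t)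
    (ht1 : t < 1) (hst : s + t < 2) : ∫⁻ w, ‖1 - w‖ₑ ^ (-s) * wt t w ∂dA < ∞ := by
  -- With this exponent both one-dimensional integrals converge.
  obtain ⟨κ, rfl⟩ : ∃ κ, s = κ * (2 - t) := ⟨s / (2 - t), (div_mul_cancel₀ s (by linarith)).symm⟩
  have hκ0 : 0 ≤ κ := nonneg_of_mul_nonneg_left hs (by linarith)
  have hκ1 : κ < 1 := by nlinarith
  refine (lintegral_dA_le_of_le_polar
    (A := fun ρ => ENNReal.ofReal (1 - ρ) ^ (-(κ * (2 - t) + t - κ)))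
    (B := fun θ => ENNReal.ofReal (|θ| / Real.pi) ^ (-κ)) (by fun_prop) (by fun_prop)
    fun ρ hρ θ hθ => enorm_one_sub_rpow_mul_wt_le ht hκ0 (by nlinarith) hρ
      (abs_le.2 ⟨hθ.1.le, hθ.2.le⟩)).trans_lt (ENNReal.mul_lt_top ?_ (ENNReal.mul_lt_top ?_ ?_))
  · simp [Real.pi_pos]
  · rw [setLIntegral_Ioo_comp_sub_left (fun x => ENNReal.ofReal x ^ (-(κ * (2 - t) + t - κ)))]
    exact setLIntegral_Ioo_rpow_neg_lt_top one_pos (by nlinarith)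
  · refine (setLIntegral_Ioo_comp_abs_le
      (fun x => ENNReal.ofReal (x / Real.pi) ^ (-κ)) Real.pi).trans_lt ?_
    refine ENNReal.mul_lt_top (by simp) ?_
    have hscale (x : ℝ) : ENNReal.ofReal (x / Real.pi) ^ (-κ) =
        ENNReal.ofReal Real.pi⁻¹ ^ (-κ) * ENNReal.ofReal x ^ (-κ) := by
      rw [← ENNReal.mul_rpow_of_ne_top ENNReal.ofReal_ne_top ENNReal.ofReal_ne_top,
        ← ENNReal.ofReal_mul (by positivity), div_eq_inv_mul]
    have hconst : ENNReal.ofReal Real.pi⁻¹ ^ (-κ) ≠ ∞ :=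
      ENNReal.rpow_ne_top_of_ne_zero (by simp [Real.pi_pos]) ENNReal.ofReal_ne_top
    simp only [hscale, lintegral_const_mul' _ _ hconst]
    exact ENNReal.mul_lt_top hconst.lt_top (setLIntegral_Ioo_rpow_neg_lt_top Real.pi_pos hκ1)

lemma exists_norm_eq_one_norm_one_sub_conj_mul_le (z : 𝔻) : ∃ ζ : ℂ, ‖ζ‖ = 1 ∧
    ∀ w ∈ ball (0 : ℂ) 1, ‖1 - ζ * w‖ ≤ 2 * ‖1 - conj (z : ℂ) * w‖ := by
  obtain ⟨ζ, hζ, hz⟩ : ∃ ζ : ℂ, ‖ζ‖ = 1 ∧ conj (z : ℂ) = ‖(z : ℂ)‖ * ζ :=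
    ⟨exp (I * (conj (z : ℂ)).arg), Complex.norm_exp_I_mul_ofReal _, by
      rw [← RCLike.norm_conj (z : ℂ), mul_comm I, Complex.norm_mul_exp_arg_mul_I]⟩
  refine ⟨ζ, hζ, fun w hw => ?_⟩
  rw [mem_ball_zero_iff] at hw
  have hdist : ‖(1 - conj (z : ℂ) * w) - (1 - ζ * w)‖ ≤ 1 - ‖(z : ℂ)‖ := by
    have : (1 - conj (z : ℂ) * w) - (1 - ζ * w) = (1 - ‖(z : ℂ)‖ : ℝ) * (ζ * w) := by
      rw [hz]; push_cast; ring
    rw [this, norm_mul, norm_mul, hζ, one_mul,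
      Complex.norm_of_nonneg (sub_nonneg.2 z.norm_lt_one.le)]
    exact mul_le_of_le_one_right (sub_nonneg.2 z.norm_lt_one.le) hw.le
  have hradial : 1 - ‖(z : ℂ)‖ ≤ ‖1 - conj (z : ℂ) * w‖ := by
    have h := norm_sub_norm_le (1 : ℂ) (conj (z : ℂ) * w)
    rw [norm_one, norm_mul, RCLike.norm_conj] at h
    nlinarith [norm_nonneg (z : ℂ)]
  have htri := norm_sub_norm_le (1 - ζ * w) (1 - conj (z : ℂ) * w)
  rw [norm_sub_rev (1 - ζ * w)] at htri
  linarith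

lemma enorm_one_sub_conj_mul_ne_zero (z : 𝔻) {w : ℂ} (hw : w ∈ ball (0 : ℂ) 1) :
    ‖1 - conj (z : ℂ) * w‖ₑ ≠ 0 :=
  enorm_ne_zero.2 (den_ne z hw)

theorem exists_lintegral_enorm_one_sub_conj_mul_rpow_mul_wt_le {s t : ℝ} (hs : 0 ≤ s)
    (ht : 0 ≤ t) (ht1 : t < 1) (hst : s + t < 2) : ∃ C : ℝ≥0, ∀ z : 𝔻,
      ∫⁻ w, ‖1 - conj (z : ℂ) * w‖ₑ ^ (-s) * wt t w ∂dA ≤ C := by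
  have hfin := lintegral_enorm_one_sub_rpow_mul_wt_lt_top hs ht ht1 hst
  have htwo : (2 : ℝ≥0∞) ^ s ≠ ∞ := ENNReal.rpow_ne_top_of_nonneg hs (by simp)
  refine ⟨(2 ^ s * ∫⁻ w, ‖1 - w‖ₑ ^ (-s) * wt t w ∂dA).toNNReal, fun z => ?_⟩
  obtain ⟨ζ, hζ, hle⟩ := exists_norm_eq_one_norm_one_sub_conj_mul_le z
  have hmeas : Measurable fun w : ℂ => ‖1 - w‖ₑ ^ (-s) * wt t w :=
    Measurable.mul (by fun_prop) (measurable_wt t)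
  rw [ENNReal.coe_toNNReal (ENNReal.mul_ne_top htwo hfin.ne),
    ← (measurePreserving_mul hζ).lintegral_comp hmeas, ← lintegral_const_mul' _ _ htwo]
  refine lintegral_mono_ae ?_
  filter_upwards [ae_mem_ball] with w hw
  have henorm : ‖1 - ζ * w‖ₑ ≤ 2 * ‖1 - conj (z : ℂ) * w‖ₑ := by
    rw [← ofReal_norm, ← ofReal_norm, ← ENNReal.ofReal_ofNat 2,
      ← ENNReal.ofReal_mul zero_le_two]
    exact ENNReal.ofReal_le_ofReal (hle w hw)
  have hpow := ennreal_rpow_neg_le_rpow_neg henorm hs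
  rw [ENNReal.mul_rpow_of_ne_zero (by simp) (enorm_one_sub_conj_mul_ne_zero z hw)] at hpow
  rw [wt_mul_left hζ, ← mul_assoc]
  gcongr
  calc ‖1 - conj (z : ℂ) * w‖ₑ ^ (-s)
      = 2 ^ s * (2 ^ (-s) * ‖1 - conj (z : ℂ) * w‖ₑ ^ (-s)) := by
        rw [← mul_assoc, ← ENNReal.rpow_add _ _ (by simp) (by simp), add_neg_cancel,
          ENNReal.rpow_zero, one_mul]
    _ ≤ 2 ^ s * ‖1 - ζ * w‖ₑ ^ (-s) := by gcongr

lemma lintegral_wt_lt_top {t : ℝ} (ht : 0 ≤ t) (ht1 : t < 1) : ∫⁻ w, wt t w ∂dA < ∞ := by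
  simpa using lintegral_enorm_one_sub_rpow_mul_wt_lt_top le_rfl ht ht1 (by linarith)

/-! ### Weighted estimates for `S K_z` -/

lemma wt_phi (t : ℝ) (z : 𝔻) {w : ℂ} (hw : w ∈ ball (0 : ℂ) 1) :
    wt t (phi z w) = wt t z * wt t w * ‖1 - conj (z : ℂ) * w‖ₑ ^ (2 * t) := by
  have hden : 0 < ‖1 - conj (z : ℂ) * w‖ := norm_pos_iff.2 (den_ne z hw)
  have hz := ofReal_one_sub_norm_sq_ne_zero (coe_mem_ball z)
  have hw' := ofReal_one_sub_norm_sq_ne_zero hw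
  rw [wt, wt, wt, one_sub_norm_phi_sq z hw, ENNReal.ofReal_div_of_pos (by positivity),
    div_eq_mul_inv, ENNReal.ofReal_mul (one_sub_norm_sq_pos (coe_mem_ball z)).le,
    ENNReal.mul_rpow_of_ne_zero (mul_ne_zero hz hw')
      (ENNReal.inv_ne_zero.2 ENNReal.ofReal_ne_top),
    ENNReal.mul_rpow_of_ne_zero hz hw']
  congr 1
  rw [ENNReal.inv_rpow, ENNReal.rpow_neg, inv_inv, ENNReal.ofReal_pow hden.le, ofReal_norm,
    ENNReal.rpow_mul, ENNReal.rpow_two]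

lemma wt_one_mul_enorm_deriv_phi (z : 𝔻) {w : ℂ} (hw : w ∈ ball (0 : ℂ) 1) :
    wt 1 z * ‖deriv (phi z) w‖ₑ = ‖1 - conj (z : ℂ) * w‖ₑ ^ (-2 : ℝ) := by
  have hden : 0 < ‖1 - conj (z : ℂ) * w‖ := norm_pos_iff.2 (den_ne z hw)
  have hz := ofReal_one_sub_norm_sq_ne_zero (coe_mem_ball z)
  rw [← ofReal_norm (deriv (phi z) w), norm_deriv_phi z hw,
    ENNReal.ofReal_div_of_pos (by positivity), wt, ENNReal.rpow_neg_one, div_eq_mul_inv,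
    ← mul_assoc, ENNReal.inv_mul_cancel hz ENNReal.ofReal_ne_top, one_mul,
    ENNReal.ofReal_pow hden.le, ofReal_norm, ENNReal.rpow_neg, ENNReal.rpow_two]

lemma enorm_toFun_apply_K (S : L2a →L[ℂ] L2a) (z : 𝔻) {w : ℂ} (hw : w ∈ ball (0 : ℂ) 1) :
    ‖toFun (S (K z)) w‖ₑ =
      wt 1 z * (‖toFun (conjBy S z one) (phi z w)‖ₑ * ‖deriv (phi z) w‖ₑ) := by
  have hSK : S (K z) = -((1 - ‖(z : ℂ)‖ ^ 2 : ℝ) : ℂ)⁻¹ • U z (conjBy S z one) := by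
    conv_lhs => rw [K_eq, map_smul, ← U_U z (S (U z one))]
    rfl
  have hscalar : ‖-((1 - ‖(z : ℂ)‖ ^ 2 : ℝ) : ℂ)⁻¹‖ₑ = wt 1 z := by
    have hz := one_sub_norm_sq_pos (coe_mem_ball z)
    rw [← ofReal_norm, norm_neg, norm_inv, Complex.norm_of_nonneg hz.le,
      ENNReal.ofReal_inv_of_pos hz, wt, ENNReal.rpow_neg_one]
  rw [hSK, toFun_smul _ _ hw, Pi.smul_apply, toFun_U z _ hw, pullback, smul_eq_mul, enorm_mul,
    enorm_mul, hscalar]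

lemma lintegral_enorm_toFun_apply_K_mul_wt (S : L2a →L[ℂ] L2a) (z : 𝔻) (a : ℝ) :
    ∫⁻ w, ‖toFun (S (K z)) w‖ₑ * wt a w ∂dA =
      wt a z * ∫⁻ w, ‖toFun (conjBy S z one) w‖ₑ *
        (‖1 - conj (z : ℂ) * w‖ₑ ^ (-(2 - 2 * a)) * wt a w) ∂dA := by
  rw [← lintegral_const_mul' _ _ (wt_ne_top a (coe_mem_ball z)), ← lintegral_comp_phi z]
  apply lintegral_congr_ae
  filter_upwards [ae_mem_ball] with w hw
  have hderiv : ‖deriv (phi z) (phi z w)‖ₑ * ‖deriv (phi z) w‖ₑ = 1 := by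
    rw [← enorm_mul, deriv_phi_mul_deriv_phi z hw, enorm_one]
  have hsplit : ‖1 - conj (z : ℂ) * w‖ₑ ^ (-(2 - 2 * a)) =
      wt 1 z * ‖deriv (phi z) w‖ₑ * ‖1 - conj (z : ℂ) * w‖ₑ ^ (2 * a) := by
    rw [wt_one_mul_enorm_deriv_phi z hw,
      ← ENNReal.rpow_add _ _ (enorm_one_sub_conj_mul_ne_zero z hw) enorm_ne_top]
    ring_nf
  rw [enorm_toFun_apply_K S z (phi_mem z hw), phi_phi z hw, wt_phi a z hw, hsplit]
  calc _ = (‖deriv (phi z) (phi z w)‖ₑ * ‖deriv (phi z) w‖ₑ) * (‖deriv (phi z) w‖ₑ * (wt 1 z *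
        ‖toFun (conjBy S z one) w‖ₑ) * (wt a z * wt a w *
          ‖1 - conj (z : ℂ) * w‖ₑ ^ (2 * a))) := by ring
    _ = _ := by rw [hderiv]; ring

lemma exists_lintegral_enorm_toFun_K_mul_wt_le {ε : ℝ} (hε : ε ∈ Ioo (0 : ℝ) 1) :
    ∃ C : ℝ≥0, ∀ z : 𝔻, ∫⁻ w, ‖toFun (K z) w‖ₑ * wt ε w ∂dA ≤ C * wt ε z := by
  obtain ⟨C, hC⟩ := exists_lintegral_enorm_one_sub_conj_mul_rpow_mul_wt_le
    (s := 2 - 2 * ε) (t := ε) (by linarith [hε.2]) hε.1.le hε.2 (by linarith [hε.1])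
  refine ⟨C, fun z => ?_⟩
  have hconj : conjBy (1 : L2a →L[ℂ] L2a) z one = one := U_U z one
  have hK := lintegral_enorm_toFun_apply_K_mul_wt 1 z ε
  rw [hconj, one_apply_eq_self] at hK
  rw [hK, mul_comm]
  gcongr
  refine (lintegral_congr_ae ?_).trans_le (hC z)
  filter_upwards [ae_mem_ball] with w hw
  rw [toFun_one hw, enorm_one, one_mul]

/-! ### Growth spaces -/

lemma aemeasurable_enorm_toFun (f : L2a) : AEMeasurable (fun w => ‖toFun f w‖ₑ) dA :=
  (aestronglyMeasurable_of_diff (toFun_diff f)).enorm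

lemma enorm_inner_toeplitz_le (u : Lp ℂ ∞ dA) (f g : L2a) :
    ‖inner ℂ f (toeplitz u g)‖ₑ ≤ ‖u‖ₑ * ∫⁻ w, ‖toFun f w‖ₑ * ‖toFun g w‖ₑ ∂dA := by
  have hproj : inner ℂ f (toeplitz u g) =
      inner ℂ (f : Lp ℂ 2 dA) ((ContinuousLinearMap.mul ℂ ℂ).holderL dA ∞ 2 2 u g) :=
    L2a.inner_orthogonalProjectionOnto_eq_of_mem_left f _
  have hu : ∀ᵐ w ∂dA, ‖u w‖ₑ ≤ ‖u‖ₑ := by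
    rw [Lp.enorm_def, eLpNorm_exponent_top]
    exact enorm_ae_le_eLpNormEssSup _ _
  have hmul : (ContinuousLinearMap.mul ℂ ℂ).holderL dA ∞ 2 2 u g =ᵐ[dA]
      fun w => u w * (g : Lp ℂ 2 dA) w :=
    (ContinuousLinearMap.mul ℂ ℂ).coeFn_holder (r := 2) u (g : Lp ℂ 2 dA)
  rw [hproj, L2.inner_def, ← lintegral_const_mul' _ _ enorm_ne_top]
  refine (enorm_integral_le_lintegral_enorm _).trans (lintegral_mono_ae ?_)
  filter_upwards [hu, hmul, toFun_ae f, toFun_ae g] with w hu hmul hf hg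
  rw [hmul, hf, hg, RCLike.inner_apply, enorm_mul, enorm_mul, RCLike.enorm_conj, mul_assoc,
    mul_comm ‖toFun g w‖ₑ]
  gcongr

/-- The norm of the growth space of functions that are `O((1 - ‖w‖ ^ 2) ^ (-ε))` on the disk. -/
noncomputable def growthNorm (ε : ℝ) (f : L2a) : ℝ≥0∞ := ⨆ w : 𝔻, ‖toFun f w‖ₑ / wt ε w

lemma growthNorm_le_iff {ε : ℝ} {f : L2a} {c : ℝ≥0∞} :
    growthNorm ε f ≤ c ↔ ∀ w ∈ ball (0 : ℂ) 1, ‖toFun f w‖ₑ ≤ c * wt ε w := by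
  have hdiv (w : 𝔻) : ‖toFun f w‖ₑ / wt ε w ≤ c ↔ ‖toFun f w‖ₑ ≤ c * wt ε w :=
    ENNReal.div_le_iff (wt_ne_zero ε (coe_mem_ball w)) (wt_ne_top ε (coe_mem_ball w))
  simp only [growthNorm, iSup_le_iff, hdiv]
  refine ⟨fun h w hw => ?_, fun h w => h w (coe_mem_ball w)⟩
  lift w to 𝔻 using mem_ball_zero_iff.1 hw
  exact h w

lemma enorm_toFun_le_growthNorm_mul_wt (ε : ℝ) (f : L2a) {w : ℂ} (hw : w ∈ ball (0 : ℂ) 1) :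
    ‖toFun f w‖ₑ ≤ growthNorm ε f * wt ε w :=
  growthNorm_le_iff.1 le_rfl w hw

lemma growthNorm_add_le (ε : ℝ) (f g : L2a) :
    growthNorm ε (f + g) ≤ growthNorm ε f + growthNorm ε g := by
  refine growthNorm_le_iff.2 fun w hw => ?_
  rw [toFun_add _ _ hw, Pi.add_apply, add_mul]
  exact (enorm_add_le _ _).trans (add_le_add (enorm_toFun_le_growthNorm_mul_wt ε f hw)
    (enorm_toFun_le_growthNorm_mul_wt ε g hw))

lemma growthNorm_smul_le (ε : ℝ) (c : ℂ) (f : L2a) :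
    growthNorm ε (c • f) ≤ ‖c‖ₑ * growthNorm ε f := by
  refine growthNorm_le_iff.2 fun w hw => ?_
  rw [toFun_smul _ _ hw, Pi.smul_apply, smul_eq_mul, enorm_mul, mul_assoc]
  gcongr
  exact enorm_toFun_le_growthNorm_mul_wt ε f hw

lemma growthNorm_one_le {ε : ℝ} (hε : 0 ≤ ε) : growthNorm ε one ≤ 1 := by
  refine growthNorm_le_iff.2 fun w hw => ?_
  rw [toFun_one hw, enorm_one, one_mul]
  exact one_le_wt hε w

/-- The conjugates `conjBy T z` are bounded on each growth space of exponent in `(0, 1)`, uniformly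
in `z`. -/
def GrowthBounded (T : L2a →L[ℂ] L2a) : Prop :=
  ∀ ε ∈ Ioo (0 : ℝ) 1, ∃ C : ℝ≥0, ∀ (z : 𝔻) (f : L2a),
    growthNorm ε (conjBy T z f) ≤ C * growthNorm ε f

lemma lintegral_enorm_toFun_U_mul (z : 𝔻) (f g : L2a) :
    ∫⁻ w, ‖toFun (U z f) w‖ₑ * ‖toFun (U z g) w‖ₑ ∂dA =
      ∫⁻ w, ‖toFun f w‖ₑ * ‖toFun g w‖ₑ ∂dA := by
  rw [← lintegral_comp_phi z (fun w => ‖toFun f w‖ₑ * ‖toFun g w‖ₑ)]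
  apply lintegral_congr_ae
  filter_upwards [ae_mem_ball] with w hw
  rw [toFun_U z f hw, toFun_U z g hw, pullback, pullback, enorm_mul, enorm_mul]
  ring

lemma GrowthBounded.of_enorm_inner_le {T : L2a →L[ℂ] L2a} {M : ℝ≥0}
    (hT : ∀ f g, ‖inner ℂ f (T g)‖ₑ ≤ M * ∫⁻ w, ‖toFun f w‖ₑ * ‖toFun g w‖ₑ ∂dA) :
    GrowthBounded T := by
  intro ε hε
  obtain ⟨C, hC⟩ := exists_lintegral_enorm_toFun_K_mul_wt_le hε
  refine ⟨M * C, fun z f => growthNorm_le_iff.2 fun w hw => ?_⟩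
  lift w to 𝔻 using mem_ball_zero_iff.1 hw
  calc ‖toFun (conjBy T z f) w‖ₑ
      = ‖inner ℂ (U z (K w)) (T (U z f))‖ₑ := by rw [← inner_K, inner_conjBy]
    _ ≤ M * ∫⁻ v, ‖toFun (K w) v‖ₑ * ‖toFun f v‖ₑ ∂dA := by
        rw [← lintegral_enorm_toFun_U_mul z]
        exact hT _ _
    _ ≤ M * ∫⁻ v, growthNorm ε f * (‖toFun (K w) v‖ₑ * wt ε v) ∂dA := by
        gcongr 1
        refine lintegral_mono_ae ?_
        filter_upwards [ae_mem_ball] with v hv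
        rw [mul_left_comm]
        gcongr
        exact enorm_toFun_le_growthNorm_mul_wt ε f hv
    _ = M * (growthNorm ε f * ∫⁻ v, ‖toFun (K w) v‖ₑ * wt ε v ∂dA) := by
        congr 1
        exact lintegral_const_mul'' _
          ((aemeasurable_enorm_toFun _).mul (measurable_wt ε).aemeasurable)
    _ ≤ M * (growthNorm ε f * (C * wt ε w)) := by gcongr; exact hC w
    _ = (M * C : ℝ≥0) * growthNorm ε f * wt ε w := by push_cast; ring

lemma conjBy_mul (S T : L2a →L[ℂ] L2a) (z : 𝔻) (f : L2a) :
    conjBy (S * T) z f = conjBy S z (conjBy T z f) := by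
  change U z (S (T (U z f))) = U z (S (U z (U z (T (U z f)))))
  rw [U_U]

lemma conjBy_add (S T : L2a →L[ℂ] L2a) (z : 𝔻) (f : L2a) :
    conjBy (S + T) z f = conjBy S z f + conjBy T z f :=
  (U z).map_add _ _

lemma conjBy_algebraMap (c : ℂ) (z : 𝔻) (f : L2a) :
    conjBy (algebraMap ℂ (L2a →L[ℂ] L2a) c) z f = c • f := by
  change U z (algebraMap ℂ (L2a →L[ℂ] L2a) c (U z f)) = c • f
  rw [ContinuousLinearMap.algebraMap_apply, map_smul, U_U]

lemma GrowthBounded.mul {S T : L2a →L[ℂ] L2a} (hS : GrowthBounded S) (hT : GrowthBounded T) :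
    GrowthBounded (S * T) := by
  intro ε hε
  obtain ⟨C, hC⟩ := hS ε hε
  obtain ⟨D, hD⟩ := hT ε hε
  refine ⟨C * D, fun z f => ?_⟩
  rw [conjBy_mul, ENNReal.coe_mul, mul_assoc]
  refine (hC z _).trans ?_
  gcongr
  exact hD z f

lemma GrowthBounded.add {S T : L2a →L[ℂ] L2a} (hS : GrowthBounded S) (hT : GrowthBounded T) :
    GrowthBounded (S + T) := by
  intro ε hε
  obtain ⟨C, hC⟩ := hS ε hε
  obtain ⟨D, hD⟩ := hT ε hε
  refine ⟨C + D, fun z f => ?_⟩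
  rw [conjBy_add, ENNReal.coe_add, add_mul]
  exact (growthNorm_add_le ε _ _).trans (add_le_add (hC z f) (hD z f))

lemma growthBounded_algebraMap (c : ℂ) :
    GrowthBounded (algebraMap ℂ (L2a →L[ℂ] L2a) c) := by
  refine fun ε _ => ⟨‖c‖₊, fun z f => ?_⟩
  rw [conjBy_algebraMap]
  exact growthNorm_smul_le ε c f

/-- The operators that are growth bounded together with their adjoints. -/
noncomputable def growthAlgebra : StarSubalgebra ℂ (L2a →L[ℂ] L2a) where
  carrier := {T | GrowthBounded T ∧ GrowthBounded (ContinuousLinearMap.adjoint T)}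
  mul_mem' {S T} hS hT := by
    refine ⟨hS.1.mul hT.1, ?_⟩
    rw [← ContinuousLinearMap.star_eq_adjoint, star_mul]
    exact hT.2.mul hS.2
  add_mem' {S T} hS hT := by
    refine ⟨hS.1.add hT.1, ?_⟩
    rw [map_add]
    exact hS.2.add hT.2
  algebraMap_mem' c := by
    refine ⟨growthBounded_algebraMap c, ?_⟩
    rw [← ContinuousLinearMap.star_eq_adjoint, ← algebraMap_star_comm]
    exact growthBounded_algebraMap (star c)
  star_mem' {T} hT := ⟨hT.2, (ContinuousLinearMap.adjoint_adjoint T).symm ▸ hT.1⟩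

theorem toeplitz_mem_growthAlgebra (u : Lp ℂ ∞ dA) : toeplitz u ∈ growthAlgebra := by
  refine ⟨.of_enorm_inner_le (M := ‖u‖₊) (enorm_inner_toeplitz_le u),
    .of_enorm_inner_le (M := ‖u‖₊) fun f g => ?_⟩
  rw [ContinuousLinearMap.adjoint_inner_right, ← ofReal_norm, norm_inner_symm, ofReal_norm]
  simp only [mul_comm ‖toFun f _‖ₑ]
  exact enorm_inner_toeplitz_le u g f

/-- The supremum over `z` of the `Lᵖ` norms of `S_z 1`. -/
noncomputable def orbitNorm (p : ℝ≥0∞) (S : L2a →L[ℂ] L2a) : ℝ≥0∞ :=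
  ⨆ z : 𝔻, eLpNorm (conjBy S z one : Lp ℂ 2 dA) p dA

lemma eLpNorm_coe (f : L2a) (p : ℝ≥0∞) :
    eLpNorm (f : Lp ℂ 2 dA) p dA = eLpNorm (toFun f) p dA :=
  eLpNorm_congr_ae (toFun_ae f)

lemma eLpNorm_le_growthNorm_mul (ε : ℝ) (p : ℝ≥0∞) {f : L2a} {c : ℝ≥0}
    (hf : growthNorm ε f ≤ c) : eLpNorm (f : Lp ℂ 2 dA) p dA ≤ c * eLpNorm (wt ε) p dA := by
  rw [eLpNorm_coe]
  refine eLpNorm_le_nnreal_smul_eLpNorm_of_ae_le_mul' ?_ p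
  filter_upwards [ae_mem_ball] with w hw
  exact growthNorm_le_iff.1 hf w hw

lemma eLpNorm_wt_lt_top {ε : ℝ} {p : ℝ≥0∞} (hε : 0 ≤ ε) (hp : p ≠ ∞) (hεp : ε * p.toReal < 1) :
    eLpNorm (wt ε) p dA < ∞ := by
  rcases eq_or_ne p 0 with rfl | hp0
  · simp
  rw [eLpNorm_lt_top_iff_lintegral_rpow_enorm_lt_top hp0 hp]
  simp only [enorm_eq_self, wt_rpow]
  exact lintegral_wt_lt_top (mul_nonneg hε ENNReal.toReal_nonneg) hεp

theorem GrowthBounded.orbitNorm_lt_top {T : L2a →L[ℂ] L2a} (hT : GrowthBounded T) {p : ℝ≥0∞}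
    (hp : p < ∞) : orbitNorm p T < ∞ := by
  obtain ⟨ε, hε, hεp⟩ : ∃ ε ∈ Ioo (0 : ℝ) 1, ε * p.toReal < 1 := by
    have hp0 : 0 ≤ p.toReal := ENNReal.toReal_nonneg
    refine ⟨1 / (p.toReal + 2), ⟨by positivity, ?_⟩, ?_⟩
    · rw [div_lt_one (by positivity)]
      linarith
    · rw [one_div_mul_eq_div, div_lt_one (by positivity)]
      linarith
  obtain ⟨C, hC⟩ := hT ε hε
  have hone (z : 𝔻) : growthNorm ε (conjBy T z one) ≤ C :=
    (hC z one).trans (mul_le_of_le_one_right zero_le (growthNorm_one_le hε.1.le))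
  exact (iSup_le fun z => eLpNorm_le_growthNorm_mul ε p (hone z)).trans_lt
    (ENNReal.mul_lt_top ENNReal.coe_lt_top (eLpNorm_wt_lt_top hε.1.le hp.ne hεp))

/-! ### Compactness from the decay of `S_z 1` -/

-- With the weight exponent `2 / 3` and `1 / p + 1 / p' = 1`, the kernel and weight exponents both
-- become `2 * p' / 3`, which is less than `1` exactly when `3 < p`.
theorem exists_lintegral_enorm_toFun_apply_K_mul_wt_le {q : ℝ≥0∞} (hq : 3 < q) :
    ∃ C : ℝ≥0, ∀ (S : L2a →L[ℂ] L2a) (z : 𝔻),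
      ∫⁻ w, ‖toFun (S (K z)) w‖ₑ * wt (2 / 3) w ∂dA ≤
        C * eLpNorm (conjBy S z one : Lp ℂ 2 dA) q dA * wt (2 / 3) z := by
  obtain ⟨p, hp, hpq⟩ := ENNReal.lt_iff_exists_nnreal_btwn.1 hq
  have hp3 : (3 : ℝ) < p := by exact_mod_cast hp
  set p' := (p : ℝ).conjExponent with hp'_def
  have hpp' : (p : ℝ).HolderConjugate p' := .conjExponent (by linarith)
  have hp' : p' < 3 / 2 := by
    rw [hp'_def, Real.conjExponent, div_lt_div_iff₀ (by linarith) two_pos]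
    linarith
  have hp'0 : 0 ≤ p' := hpp'.symm.nonneg
  obtain ⟨C, hC⟩ := exists_lintegral_enorm_one_sub_conj_mul_rpow_mul_wt_le
    (s := 2 / 3 * p') (t := 2 / 3 * p') (by positivity) (by positivity) (by linarith) (by linarith)
  refine ⟨C ^ (1 / p'), fun S z => ?_⟩
  have hmeas := measurable_wt (2 / 3)
  have hpow (w : ℂ) : (‖1 - conj (z : ℂ) * w‖ₑ ^ (-(2 / 3) : ℝ) * wt (2 / 3) w) ^ p' =
      ‖1 - conj (z : ℂ) * w‖ₑ ^ (-(2 / 3 * p')) * wt (2 / 3 * p') w := by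
    rw [ENNReal.mul_rpow_of_nonneg _ _ hp'0, ← ENNReal.rpow_mul, wt_rpow, neg_mul]
  calc ∫⁻ w, ‖toFun (S (K z)) w‖ₑ * wt (2 / 3) w ∂dA
      = wt (2 / 3) z * ∫⁻ w, ‖toFun (conjBy S z one) w‖ₑ *
          (‖1 - conj (z : ℂ) * w‖ₑ ^ (-(2 / 3) : ℝ) * wt (2 / 3) w) ∂dA := by
        rw [lintegral_enorm_toFun_apply_K_mul_wt]
        norm_num
    _ ≤ wt (2 / 3) z * (eLpNorm (toFun (conjBy S z one)) p dA * (C : ℝ≥0∞) ^ (1 / p')) := by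
        gcongr
        refine (ENNReal.lintegral_mul_le_Lp_mul_Lq dA hpp'
          (aemeasurable_enorm_toFun (conjBy S z one)) (by fun_prop)).trans ?_
        rw [eLpNorm_nnreal_eq_lintegral (by rintro rfl; norm_num at hp3)]
        simp only [hpow]
        gcongr
        exact hC z
    _ ≤ wt (2 / 3) z * (eLpNorm (toFun (conjBy S z one)) q dA * (C : ℝ≥0∞) ^ (1 / p')) := by
        gcongr
        exact eLpNorm_le_eLpNorm_of_exponent_le hpq.le
          (aestronglyMeasurable_of_diff (toFun_diff _))
    _ = _ := by
        rw [eLpNorm_coe, ENNReal.coe_rpow_of_nonneg _ (by positivity)]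
        ring

lemma enorm_sq_eq_lintegral (f : L2a) : ‖f‖ₑ ^ 2 = ∫⁻ w, ‖toFun f w‖ₑ ^ 2 ∂dA := by
  have h : ‖f‖ₑ = eLpNorm (toFun f) 2 dA := by
    rw [← eLpNorm_coe, ← Lp.enorm_def]
    rfl
  rw [h, eLpNorm_eq_lintegral_rpow_enorm_toReal two_ne_zero ENNReal.ofNat_ne_top,
    ← ENNReal.rpow_two, ← ENNReal.rpow_mul]
  simp

lemma enorm_toFun_adjoint_apply_K (S : L2a →L[ℂ] L2a) (z w : 𝔻) :
    ‖toFun (ContinuousLinearMap.adjoint S (K w)) z‖ₑ = ‖toFun (S (K z)) w‖ₑ := by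
  rw [← inner_K, ← inner_K, ContinuousLinearMap.adjoint_inner_right, ← ofReal_norm,
    norm_inner_symm, ofReal_norm]

lemma continuousOn_conjKernel_conj :
    ContinuousOn (fun z : ℂ => conjKernel (conj z)) (ball 0 1) :=
  differentiableOn_conjKernel.continuousOn.comp Complex.continuous_conj.continuousOn
    fun _ => conj_mem_ball

lemma dA_restrict_ball : dA.restrict (ball 0 1) = dA :=
  Measure.restrict_eq_self_of_ae_mem ae_mem_ball

lemma aemeasurable_uncurry_enorm_toFun_apply_conjKernel (S : L2a →L[ℂ] L2a) :
    AEMeasurable (Function.uncurry fun z w => ‖toFun (S (conjKernel (conj z))) w‖ₑ)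
      (dA.prod dA) := by
  have hcont : ContinuousOn (fun p : ℂ × ℂ => ‖inner ℂ (conjKernel (conj p.2))
      (S (conjKernel (conj p.1)))‖ₑ) (ball (0 : ℂ) 1 ×ˢ ball (0 : ℂ) 1) :=
    (ContinuousOn.inner (𝕜 := ℂ)
      (continuousOn_conjKernel_conj.comp continuousOn_snd fun p hp => hp.2)
      (S.continuous.comp_continuousOn
        (continuousOn_conjKernel_conj.comp continuousOn_fst fun p hp => hp.1))).enorm
  have hball : MeasurableSet (ball (0 : ℂ) 1 ×ˢ ball (0 : ℂ) 1) :=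
    measurableSet_ball.prod measurableSet_ball
  have hprod : (dA.prod dA).restrict (ball 0 1 ×ˢ ball 0 1) = dA.prod dA := by
    rw [← Measure.prod_restrict, dA_restrict_ball]
  have hmeas := hcont.aemeasurable (μ := dA.prod dA) hball
  have hmem := ae_restrict_mem (μ := dA.prod dA) hball
  rw [hprod] at hmeas hmem
  refine hmeas.congr (hmem.mono fun p hp => ?_)
  lift p.2 to 𝔻 using mem_ball_zero_iff.1 hp.2 with w hw
  simp only [Function.uncurry, ← hw, conjKernel_conj, inner_K]

/-- The integral over the disk of radius `r` of the rank one operators `f ↦ f(z) K_z`. Over the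
whole disk these integrate to the identity. -/
noncomputable def truncation (r : ℝ) : L2a →L[ℂ] L2a :=
  ∫ z in closedBall 0 r,
    InnerProductSpace.rankOne ℂ (conjKernel (conj z)) (conjKernel (conj z)) ∂dA

lemma isCompactOperator_truncation (r : ℝ) : IsCompactOperator (truncation r) :=
  isCompactOperator_integral fun _ => isCompactOperator_rankOne _ _

lemma inner_truncation_apply {r : ℝ} (hr : r < 1) (g f : L2a) :
    inner ℂ g (truncation r f) =
      ∫ z in closedBall 0 r, conj (toFun g z) * toFun f z ∂dA := by
  have hcont := continuousOn_conjKernel_conj.mono (closedBall_subset_ball hr)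
  refine (inner_integral_rankOne_apply
    (integrableOn_rankOne (isCompact_closedBall 0 r) hcont hcont) g f).trans ?_
  refine setIntegral_congr_fun measurableSet_closedBall fun z hz => ?_
  lift z to 𝔻 using mem_ball_zero_iff.1 (closedBall_subset_ball hr hz)
  simp only [conjKernel_conj, inner_K, ← inner_conj_symm (E := L2a) g]

lemma integrable_conj_toFun_mul (f g : L2a) :
    Integrable (fun w => conj (toFun f w) * toFun g w) dA := by
  refine (L2.integrable_inner (𝕜 := ℂ) (f : Lp ℂ 2 dA) (g : Lp ℂ 2 dA)).congr ?_
  filter_upwards [toFun_ae f, toFun_ae g] with w hf hg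
  rw [hf, hg, RCLike.inner_apply, mul_comm]

lemma enorm_toFun_sub_comp_truncation_le (S : L2a →L[ℂ] L2a) {r : ℝ} (hr : r < 1) (f : L2a)
    (w : 𝔻) : ‖toFun ((S - S ∘L truncation r) f) w‖ₑ ≤
      ∫⁻ z in (closedBall 0 r)ᶜ, ‖toFun (S (conjKernel (conj z))) w‖ₑ * ‖toFun f z‖ₑ ∂dA := by
  set g := ContinuousLinearMap.adjoint S (K w) with hg
  have hinner : toFun ((S - S ∘L truncation r) f) w =
      inner ℂ g f - inner ℂ g (truncation r f) := by
    rw [← inner_K, hg, ContinuousLinearMap.adjoint_inner_left,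
      ContinuousLinearMap.adjoint_inner_left]
    exact inner_sub_right (𝕜 := ℂ) (K w) (S f) (S (truncation r f))
  have htail : toFun ((S - S ∘L truncation r) f) w =
      ∫ z in (closedBall 0 r)ᶜ, conj (toFun g z) * toFun f z ∂dA := by
    rw [hinner, inner_truncation_apply hr, inner_eq_integral,
      ← integral_add_compl measurableSet_closedBall (integrable_conj_toFun_mul g f),
      add_sub_cancel_left]
  rw [htail]
  refine (enorm_integral_le_lintegral_enorm _).trans_eq (lintegral_congr_ae ?_)
  filter_upwards [ae_restrict_of_ae ae_mem_ball] with z hz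
  lift z to 𝔻 using mem_ball_zero_iff.1 hz
  rw [enorm_mul, RCLike.enorm_conj, hg, enorm_toFun_adjoint_apply_K, conjKernel_conj]

lemma lintegral_sq_lintegral_compl_closedBall_le {S : L2a →L[ℂ] L2a} {r t : ℝ} {A B : ℝ≥0∞}
    (hA : ∀ z : 𝔻, r < ‖(z : ℂ)‖ → ∫⁻ w, ‖toFun (S (K z)) w‖ₑ * wt t w ∂dA ≤ A * wt t z)
    (hB : ∀ w : 𝔻, ∫⁻ z, ‖toFun (ContinuousLinearMap.adjoint S (K w)) z‖ₑ * wt t z ∂dA ≤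
      B * wt t w) (f : L2a) :
    ∫⁻ w, (∫⁻ z in (closedBall 0 r)ᶜ,
      ‖toFun (S (conjKernel (conj z))) w‖ₑ * ‖toFun f z‖ₑ ∂dA) ^ 2 ∂dA ≤ A * B * ‖f‖ₑ ^ 2 := by
  have hball : ∀ᵐ z ∂dA.restrict (closedBall 0 r)ᶜ, z ∈ ball (0 : ℂ) 1 :=
    ae_restrict_of_ae ae_mem_ball
  have hmeas := (measurable_wt t).aemeasurable (μ := dA)
  refine (lintegral_sq_lintegral_mul_le_of_schur
    (H := fun z w => ‖toFun (S (conjKernel (conj z))) w‖ₑ) (A := A) (B := B)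
    ((aemeasurable_uncurry_enorm_toFun_apply_conjKernel S).mono_ac
      (Measure.restrict_le_self.absolutelyContinuous.prod .rfl))
    (hmeas.mono_measure Measure.restrict_le_self) hmeas
    (hball.mono fun z hz => wt_ne_zero t hz) (hball.mono fun z hz => wt_ne_top t hz) ?_ ?_
    ((aemeasurable_enorm_toFun f).mono_measure Measure.restrict_le_self)).trans ?_
  · filter_upwards [hball, ae_restrict_mem measurableSet_closedBall.compl] with z hz hzr
    lift z to 𝔻 using mem_ball_zero_iff.1 hz
    rw [conjKernel_conj]
    exact hA z (by simpa using hzr)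
  · filter_upwards [ae_mem_ball] with w hw
    lift w to 𝔻 using mem_ball_zero_iff.1 hw
    refine (setLIntegral_le_lintegral _ _).trans ((lintegral_congr_ae ?_).trans_le (hB w))
    filter_upwards [ae_mem_ball] with z hz
    lift z to 𝔻 using mem_ball_zero_iff.1 hz
    rw [conjKernel_conj, enorm_toFun_adjoint_apply_K]
  · rw [enorm_sq_eq_lintegral]
    gcongr
    exact Measure.restrict_le_self

theorem exists_enorm_sub_comp_truncation_le {q : ℝ≥0∞} (hq : 3 < q) :
    ∃ C : ℝ≥0, ∀ (S : L2a →L[ℂ] L2a), ∀ r < 1,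
      ‖S - S ∘L truncation r‖ₑ ≤
        (C * (⨆ (z : 𝔻) (_ : r < ‖(z : ℂ)‖), eLpNorm (conjBy S z one : Lp ℂ 2 dA) q dA) *
          orbitNorm q (ContinuousLinearMap.adjoint S)) ^ (1 / 2 : ℝ) := by
  obtain ⟨C, hC⟩ := exists_lintegral_enorm_toFun_apply_K_mul_wt_le hq
  refine ⟨C * C, fun S r hr => enorm_le_rpow_half_of_sq_le fun f => ?_⟩
  calc ‖(S - S ∘L truncation r) f‖ₑ ^ 2
      ≤ ∫⁻ w, (∫⁻ z in (closedBall 0 r)ᶜ,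
          ‖toFun (S (conjKernel (conj z))) w‖ₑ * ‖toFun f z‖ₑ ∂dA) ^ 2 ∂dA := by
        rw [enorm_sq_eq_lintegral]
        refine lintegral_mono_ae (ae_mem_ball.mono fun w hw => ?_)
        lift w to 𝔻 using mem_ball_zero_iff.1 hw
        gcongr
        exact enorm_toFun_sub_comp_truncation_le S hr f w
    _ ≤ (C * ⨆ (z : 𝔻) (_ : r < ‖(z : ℂ)‖), eLpNorm (conjBy S z one : Lp ℂ 2 dA) q dA) *
          (C * orbitNorm q (ContinuousLinearMap.adjoint S)) * ‖f‖ₑ ^ 2 := by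
        refine lintegral_sq_lintegral_compl_closedBall_le (fun z hz => (hC S z).trans ?_)
          (fun w => (hC _ w).trans ?_) f
        · gcongr
          exact le_iSup₂_of_le z hz le_rfl
        · gcongr
          exact le_iSup_of_le w le_rfl
    _ = _ := by push_cast; ring

lemma tendsto_iSup_norm_lt {F : 𝔻 → ℝ≥0∞} (hF : Tendsto F toBoundary (𝓝 0)) :
    Tendsto (fun r : ℝ => ⨆ (z : 𝔻) (_ : r < ‖(z : ℂ)‖), F z) (𝓝[<] 1) (𝓝 0) := by
  refine ENNReal.tendsto_nhds_zero.2 fun ε hε => ?_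
  have hev := ENNReal.tendsto_nhds_zero.1 hF ε hε
  rw [toBoundary, eventually_comap] at hev
  obtain ⟨l, u, ⟨hl, hu⟩, hlu⟩ := mem_nhds_iff_exists_Ioo_subset.1 hev
  filter_upwards [Ioo_mem_nhdsLT hl] with r hr
  exact iSup₂_le fun z hz => hlu ⟨hr.1.trans hz, z.norm_lt_one.trans hu⟩ z rfl

theorem isCompactOperator_of_tendsto_eLpNorm {S : L2a →L[ℂ] L2a} {q : ℝ≥0∞} (hq : 3 < q)
    (hS : orbitNorm q (ContinuousLinearMap.adjoint S) < ∞)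
    (h : Tendsto (fun z => eLpNorm (conjBy S z one : Lp ℂ 2 dA) q dA) toBoundary (𝓝 0)) :
    IsCompactOperator S := by
  obtain ⟨C, hC⟩ := exists_enorm_sub_comp_truncation_le hq
  have hbound := (ENNReal.Tendsto.mul_const (ENNReal.Tendsto.const_mul (tendsto_iSup_norm_lt h)
    (.inr (ENNReal.coe_ne_top (r := C)))) (.inr hS.ne)).ennrpow_const (1 / 2)
  rw [mul_zero, zero_mul, ENNReal.zero_rpow_of_pos (by norm_num)] at hbound
  have hnorm : Tendsto (fun r => ‖S - S ∘L truncation r‖ₑ) (𝓝[<] 1) (𝓝 0) :=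
    tendsto_of_tendsto_of_tendsto_of_le_of_le' tendsto_const_nhds hbound
      (.of_forall fun _ => zero_le) (eventually_nhdsWithin_of_forall fun r hr => hC S r hr)
  have htrunc : Tendsto (fun r => S ∘L truncation r) (𝓝[<] 1) (𝓝 S) :=
    (tendsto_iff_edist_tendsto_0 (α := L2a →L[ℂ] L2a)).2 <| hnorm.congr fun r => by
      rw [edist_comm, edist_eq_enorm_sub]
  exact isCompactOperator_of_tendsto htrunc
    (.of_forall fun r => (isCompactOperator_truncation r).clm_comp S)

instance : toBoundary.IsCountablyGenerated :=
  inferInstanceAs (comap _ (𝓝 (1 : ℝ))).IsCountablyGenerated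

lemma orbitNorm_mono (S : L2a →L[ℂ] L2a) {p q : ℝ≥0∞} (hpq : p ≤ q) :
    orbitNorm p S ≤ orbitNorm q S :=
  iSup_mono fun _ => eLpNorm_le_eLpNorm_of_exponent_le hpq (Lp.aestronglyMeasurable _)

lemma norm_berezin_le (S : L2a →L[ℂ] L2a) (z : 𝔻) : ‖berezin S z‖ ≤ ‖S (k z)‖ := by
  have h : ‖berezin S z‖ ≤ ‖k z‖ * ‖S (k z)‖ := norm_inner_le_norm (𝕜 := ℂ) (k z) (S (k z))
  rwa [norm_k, one_mul] at h

lemma tendsto_toFun_of_tendsto_toWeakSpace {ι : Type*} {l : Filter ι} {f : ι → L2a}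
    (h : Tendsto (fun i => toWeakSpace ℂ L2a (f i)) l (𝓝 0)) (w : 𝔻) :
    Tendsto (fun i => toFun (f i) w) l (𝓝 0) :=
  (tendsto_toWeakSpace_zero_iff.1 h (K w)).congr fun i => inner_K w (f i)

theorem tendsto_eLpNorm_of_tendsto_toWeakSpace {ι : Type*} {l : Filter ι}
    [l.IsCountablyGenerated] {f : ι → L2a}
    (h : Tendsto (fun i => toWeakSpace ℂ L2a (f i)) l (𝓝 0)) {p q C : ℝ≥0∞} (hp : 1 ≤ p)
    (hpq : p < q) (hC : C ≠ ∞) (hfC : ∀ i, eLpNorm (f i : Lp ℂ 2 dA) q dA ≤ C) :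
    Tendsto (fun i => eLpNorm (f i : Lp ℂ 2 dA) p dA) l (𝓝 0) := by
  simp only [eLpNorm_coe] at hfC ⊢
  refine tendsto_eLpNorm_zero_of_ae_of_eLpNorm_le hp hpq hC
    (fun i => aestronglyMeasurable_of_diff (toFun_diff (f i))) hfC ?_
  filter_upwards [ae_mem_ball] with w hw
  exact tendsto_toFun_of_tendsto_toWeakSpace h ⟨w, hw⟩

end Bergman

theorem mainTheorem1_general (S : Bergman.L2a →L[ℂ] Bergman.L2a)
    (hS : ∀ p < ∞, Bergman.orbitNorm p S < ∞) {q : ℝ≥0∞} (hq : 3 < q)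
    (hS' : Bergman.orbitNorm q (ContinuousLinearMap.adjoint S) < ∞) :
    List.TFAE [
      IsCompactOperator S,
      Tendsto (fun z => ‖S (Bergman.k z)‖) Bergman.toBoundary (𝓝 0),
      Tendsto (fun z => Bergman.berezin S z) Bergman.toBoundary (𝓝 0),
      Tendsto (fun z => toWeakSpace ℂ Bergman.L2a (Bergman.conjBy S z Bergman.one))
        Bergman.toBoundary (𝓝 0),
      Tendsto (fun z => ‖Bergman.conjBy S z Bergman.one‖) Bergman.toBoundary (𝓝 0),
      ∀ p : ℝ≥0∞, 1 < p → p < ∞ →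
        Tendsto (fun z => eLpNorm (Bergman.conjBy S z Bergman.one : Lp ℂ 2 Bergman.dA) p Bergman.dA)
          Bergman.toBoundary (𝓝 0)] := by
  tfae_have 1 → 2 := fun h => tendsto_norm_apply_zero_of_isCompactOperator (𝕜 := ℂ) h
    (fun z => (Bergman.norm_k z).le) Bergman.tendsto_inner_k
  tfae_have 2 → 3 := squeeze_zero_norm (Bergman.norm_berezin_le S)
  tfae_have 3 → 4 := fun h => tendsto_toWeakSpace_zero_iff.2
    (Bergman.tendsto_inner_conjBy_of_tendsto_berezin h Bergman.one)
  tfae_have 4 → 6 := fun h p hp hp' => by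
    obtain ⟨r, hpr, hr⟩ := exists_between hp'
    exact Bergman.tendsto_eLpNorm_of_tendsto_toWeakSpace h hp.le hpr (hS r hr).ne
      (le_iSup fun z => eLpNorm (Bergman.conjBy S z Bergman.one : Lp ℂ 2 Bergman.dA) r Bergman.dA)
  tfae_have 6 → 1 := fun h =>
    have hr : 3 < min q 4 := lt_min hq (by norm_num)
    Bergman.isCompactOperator_of_tendsto_eLpNorm hr
      ((Bergman.orbitNorm_mono _ (min_le_left q 4)).trans_lt hS')
      (h _ (lt_trans (by norm_num) hr) ((min_le_right q 4).trans_lt (by norm_num)))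
  tfae_have 6 → 5 := fun h =>
    (ENNReal.tendsto_toReal ENNReal.zero_ne_top).comp (h 2 (by norm_num) (by norm_num))
  tfae_have 5 → 2 := fun h => by simpa only [Bergman.norm_conjBy_one] using h
  tfae_finish

theorem mainTheorem1 (m : ℕ) (n : Fin m → ℕ) (u : (i : Fin m) → Fin (n i) → Lp ℂ ∞ Bergman.dA)
    (S : Bergman.L2a →L[ℂ] Bergman.L2a)
    (hS : S = ∑ i, (List.ofFn fun j => Bergman.toeplitz (u i j)).prod) :
    List.TFAE [
      IsCompactOperator S,
      Tendsto (fun z => ‖S (Bergman.k z)‖) Bergman.toBoundary (𝓝 0),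
      Tendsto (fun z => Bergman.berezin S z) Bergman.toBoundary (𝓝 0),
      Tendsto (fun z => toWeakSpace ℂ Bergman.L2a (Bergman.conjBy S z Bergman.one))
        Bergman.toBoundary (𝓝 0),
      Tendsto (fun z => ‖Bergman.conjBy S z Bergman.one‖) Bergman.toBoundary (𝓝 0),
      ∀ p : ℝ≥0∞, 1 < p → p < ∞ →
        Tendsto (fun z => eLpNorm (Bergman.conjBy S z Bergman.one : Lp ℂ 2 Bergman.dA) p Bergman.dA)
          Bergman.toBoundary (𝓝 0)] := by
  have hmem : S ∈ Bergman.growthAlgebra := hS ▸ sum_mem fun i _ => list_prod_mem <|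
    List.forall_mem_ofFn_iff.2 fun j => Bergman.toeplitz_mem_growthAlgebra (u i j)
  exact mainTheorem1_general S (fun _ hp => hmem.1.orbitNorm_lt_top hp)
    (q := 4) (by norm_num) (hmem.2.orbitNorm_lt_top (by norm_num))
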